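/- Let $\mu\neq 0$ be a complex (finite) Borel measure on $(0,\infty)$ with $\int_0^\infty d\mu(t)=0$. Put $F(z)=\mathcal L\mu(z)=\int_0^\infty e^{-z\xi}\,d\mu(\xi)$ for $\operatorname{Re} z\ge 0$, and $\widetilde F=\mathcal L\overline{\mu}$, where $\overline\mu(E)=\overline{\mu(E)}$. Let $(T(t))_{t>0}$ be a strongly continuous semigroup of bounded operators on a complex Banach space $X$, that is, $T(s+t)=T(s)T(t)$ for $s,t>0$ and $t\mapsto T(t)x$ is continuous on $(0,\infty)$ for every $x\in X$. Assume that it is quasinilpotent (every $T(t)$, $t>0$, has spectral radius $0$) and nontrivial ($T(t)\ne0$ for some $t>0$). Let $A$ be its generator. For $s>0$ write $$F(-sA)x=\int_0^\infty T(s\xi)x\,d\mu(\xi),\qquad \widetilde F(-sA)x=\int_0^\infty T(s\xi)x\,d\overline\mu(\xi)\qquad(x\in X);$$ we say that $F(-sA)$ is defined if, for every $x\in X$, $\xi\mapsto T(s\xi)x$ is Bochner integrable with respect to the total variation $|\mu|$ (equivalently $|\overline\mu|$). Then: 1. If $T$ is bounded near $0$ (that is, $\sup_{0<t\le\delta}\|T(t)\|<\infty$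 for some $\delta>0$), or if $|\mu|((0,\delta))=0$ for some $\delta>0$, then $F(-sA)$ is defined for every $s>0$. 2. The maximum $\max_{x\ge0}|F(x)|^2$ exists, and there is $\eta>0$ such that for every $s$ with $0<s\le\eta$ for which $F(-sA)$ is defined, $F(-sA)$ and $\widetilde F(-sA)$ are bounded operators on $X$ and $$\big\|F(-sA)\,\widetilde F(-sA)\big\|>\max_{x\ge 0}|F(x)|^2 .$$ -/

import Mathlib

open MeasureTheory

/-- The conjugate measure `E ↦ conj (μ E)` of a complex measure `μ`. -/
noncomputable def conjMeasure {α : Type*} [MeasurableSpace α] (μ : ComplexMeasure α) :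
    ComplexMeasure α :=
  μ.mapRange (starRingEnd ℂ).toAddMonoidHom Complex.continuous_conj

/-- The Bochner integral `∫ f dμ` of a vector-valued function against a complex measure, the
pairing being scalar multiplication. It is meaningful when `f` is Bochner integrable with respect
to the total variation of `μ`. -/
noncomputable def complexIntegral {α X : Type*} [MeasurableSpace α] [NormedAddCommGroup X]
    [NormedSpace ℂ X] (μ : ComplexMeasure α) (f : α → X) : X :=
  μ.integral f (ContinuousLinearMap.lsmul ℝ ℂ : ℂ →L[ℝ] X →L[ℝ] X).flip

/-- The Laplace transform `(ℒ μ)(z) = ∫ exp (-z ξ) dμ(ξ)` of a complex Borel measure on `(0, ∞)`. -/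
noncomputable def laplace (μ : ComplexMeasure (Set.Ioi (0 : ℝ))) (z : ℂ) : ℂ :=
  complexIntegral μ (fun ξ : Set.Ioi (0 : ℝ) => Complex.exp (-z * ((ξ : ℝ) : ℂ)))

/-- `(T t)` for `t > 0` is a strongly continuous semigroup of bounded operators on `X`. Nothing is
required as `t → 0+`, and the values of `T` at `t ≤ 0` are irrelevant. -/
structure IsStronglyContinuousSemigroup {X : Type*} [NormedAddCommGroup X] [NormedSpace ℂ X]
    (T : ℝ → X →L[ℂ] X) : Prop where
  map_add : ∀ s t : ℝ, 0 < s → 0 < t → T (s + t) = (T s).comp (T t)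
  continuousOn : ∀ x : X, ContinuousOn (fun t : ℝ => T t x) (Set.Ioi 0)

/-- Every `T t` with `t > 0` has spectral radius zero. -/
def IsQuasinilpotent {X : Type*} [NormedAddCommGroup X] [NormedSpace ℂ X]
    (T : ℝ → X →L[ℂ] X) : Prop :=
  ∀ t : ℝ, 0 < t → spectralRadius ℂ (T t) = 0

/-- The integrals `∫ T (s ξ) x dμ(ξ)`, `x ∈ X`, which define `F (-s A)` for `F = ℒ μ` and the
generator `A` of `T`, all exist as Bochner integrals. -/
def CalculusDefined {X : Type*} [NormedAddCommGroup X] [NormedSpace ℂ X]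
    (T : ℝ → X →L[ℂ] X) (μ : ComplexMeasure (Set.Ioi (0 : ℝ))) (s : ℝ) : Prop :=
  ∀ x : X, μ.Integrable (fun ξ : Set.Ioi (0 : ℝ) => T (s * (ξ : ℝ)) x)

/-- The bounded operator `P` is `F (-s A)`, where `F = ℒ μ` and `A` is the generator of `T`:
for all `x`, the integral `∫ T (s ξ) x dμ(ξ)` exists as a Bochner integral and equals `P x`. -/
def IsCalculus {X : Type*} [NormedAddCommGroup X] [NormedSpace ℂ X]
    (T : ℝ → X →L[ℂ] X) (μ : ComplexMeasure (Set.Ioi (0 : ℝ))) (s : ℝ) (P : X →L[ℂ] X) : Prop :=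
  CalculusDefined T μ s ∧
    ∀ x : X, P x = complexIntegral μ (fun ξ : Set.Ioi (0 : ℝ) => T (s * (ξ : ℝ)) x)

/-!
Let `F` and `Ft` be the transforms of `μ` and its conjugate, so that `Ft z = conj (F (conj z))`, and
put `G = F * Ft`. It is bounded and holomorphic on the right half-plane, continuous up to the
boundary, satisfies `G (conj z) = conj (G z)`, equals `|F|²` on `[0, ∞)`, vanishes at `0`, and its
maximum `M` on the half-line is attained at some `x₀ > 0`.

For `y` in the range of some `T a` with `a > 0`, the transform `R z = ∫ exp (z t) • T (s t) y dt`
over `(0, ∞)` is entire, because quasinilpotency makes orbits decay faster than every exponential,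
and `‖R z‖ ≤ K / (-Re z)` on the left half-plane. Up to bounded errors `F (-s A) Ft (-s A)`
multiplies `R z` by `G z`; so if this operator has norm at most `M`, then wherever `|G z| > M` one
has `‖R z‖ ≤ C / (Re z (|G z| - M))`, with `C` independent of `s`.

Entire functions `f` subject to these two bounds are uniformly bounded at `0`. By the
Phragmén-Lindelöf principle a component of `{|G| > M}` in the upper half-plane, whose closure
contains `x₀`, reaches the imaginary axis, which gives a path from `x₀` to `-1` through the upper
half-plane along which `f` is controlled once a power of `z - x₀` cancels the singularity of the
bound at `x₀`. If `P` is that power and `h` is the product of `P f` with its conjugate reflection,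
then `h` is real on the real axis and the imaginary part of `∫ h z / z dz` along the path is
`π h 0 = π |P 0 f 0|²`.

Hence `‖∫ T t y dt‖ = s ‖R 0‖ ≤ B s`, with the left side independent of `s` and nonzero for a
suitable `y`, which is impossible for small `s`.
-/

open Filter Set Topology
open scoped ComplexConjugate

section HalfPlane

theorem isOpen_setOf_re_pos : IsOpen {z : ℂ | 0 < z.re} :=
  isOpen_lt continuous_const Complex.continuous_re

variable {E : Type*} [NormedAddCommGroup E] [NormedSpace ℂ E]

theorem eqOn_re_nonneg_of_frequently_eq [CompleteSpace E] {f g : ℂ → E}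
    (hf : DiffContOnCl ℂ f {z | 0 < z.re}) (hg : DiffContOnCl ℂ g {z | 0 < z.re}) {z₀ : ℂ}
    (hz₀ : 0 < z₀.re) (h : ∃ᶠ z in 𝓝[≠] z₀, f z = g z) : EqOn f g {z | 0 ≤ z.re} := by
  have hopen := isOpen_setOf_re_pos
  rw [← Complex.closure_setOfPred_lt_re]
  refine EqOn.of_subset_closure ?_ hf.continuousOn hg.continuousOn subset_closure le_rfl
  exact (hf.differentiableOn.analyticOnNhd hopen).eqOn_of_preconnected_of_frequently_eq
    (hg.differentiableOn.analyticOnNhd hopen) (convex_halfSpace_re_gt 0).isPreconnected hz₀ h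

theorem diffContOnCl_one_add_cpow (c : ℂ) :
    DiffContOnCl ℂ (fun z : ℂ => (1 + z) ^ c) {z | 0 < z.re} := by
  have hd : ∀ z : ℂ, 0 ≤ z.re → DifferentiableAt ℂ (fun z : ℂ => (1 + z) ^ c) z := fun z hz =>
    DifferentiableAt.cpow (by fun_prop) (by fun_prop)
      (Or.inl (by simpa using add_pos_of_pos_of_nonneg one_pos hz))
  refine ⟨fun z (hz : 0 < z.re) => (hd z hz.le).differentiableWithinAt, ?_⟩
  rw [Complex.closure_setOfPred_lt_re]
  exact fun z hz => (hd z hz).continuousAt.continuousWithinAt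

theorem norm_one_add_cpow_neg_le_one {z : ℂ} {ε : ℝ} (hz : 0 ≤ z.re) (hε : 0 ≤ ε) :
    ‖(1 + z) ^ ((-ε : ℝ) : ℂ)‖ ≤ 1 := by
  have hle : 1 ≤ ‖1 + z‖ := le_trans (by simpa using hz) (Complex.re_le_norm (1 + z))
  rw [Complex.norm_cpow_real]
  exact Real.rpow_le_one_of_one_le_of_nonpos hle (by linarith)

theorem norm_one_add_cpow_neg_le {z : ℂ} {ε : ℝ} (hε : 0 ≤ ε) (hz : 1 < ‖z‖) :
    ‖(1 + z) ^ ((-ε : ℝ) : ℂ)‖ ≤ (‖z‖ - 1) ^ (-ε) := by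
  have hle : ‖z‖ - 1 ≤ ‖1 + z‖ := by
    simpa [add_comm] using norm_sub_norm_le z (-1)
  rw [Complex.norm_cpow_real]
  exact Real.rpow_le_rpow_of_nonpos (by linarith) hle (by linarith)

theorem norm_cpow_smul_le_of_forall_mem_frontier_norm_le {f : ℂ → E} {W : Set ℂ} {M b ε : ℝ}
    (hW : W ⊆ {z | 0 < z.re}) (hf : DiffContOnCl ℂ f W) (hb : ∀ z ∈ W, ‖f z‖ ≤ b)
    (hM : ∀ z ∈ frontier W, ‖f z‖ ≤ M) (hM₀ : 0 ≤ M) (hε : 0 < ε) {z : ℂ} (hz : z ∈ W) :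
    ‖(1 + z) ^ ((-ε : ℝ) : ℂ) • f z‖ ≤ M := by
  have hWcl : closure W ⊆ {z | 0 ≤ z.re} :=
    (closure_mono hW).trans (Complex.closure_setOfPred_lt_re 0).subset
  have hbcl : ∀ w ∈ closure W, ‖f w‖ ≤ b := fun w hw =>
    le_on_closure hb hf.continuousOn.norm continuousOn_const hw
  have hbound : ∀ R : ℝ, 1 < R → ‖z‖ < R →
      ‖(1 + z) ^ ((-ε : ℝ) : ℂ) • f z‖ ≤ max M ((R - 1) ^ (-ε) * b) := by
    intro R hR hzR
    refine Complex.norm_le_of_forall_mem_frontier_norm_le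
      ((Metric.isBounded_ball (x := 0) (r := R)).subset inter_subset_right)
      (((diffContOnCl_one_add_cpow _).mono hW).smul hf |>.mono inter_subset_left) (fun w hw => ?_)
      (subset_closure ⟨hz, by simpa using hzR⟩)
    rw [norm_smul]
    rcases frontier_inter_subset _ _ hw with ⟨hwW, -⟩ | ⟨hwW, hwR⟩
    · refine le_max_of_le_left ((mul_le_of_le_one_left (norm_nonneg _) ?_).trans (hM w hwW))
      exact norm_one_add_cpow_neg_le_one (hWcl (frontier_subset_closure hwW)) hε.le
    · obtain rfl : ‖w‖ = R := by simpa using Metric.frontier_ball_subset_sphere hwR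
      exact le_max_of_le_right (mul_le_mul (norm_one_add_cpow_neg_le hε.le hR) (hbcl w hwW)
        (norm_nonneg _) (Real.rpow_nonneg (by linarith) _))
  have hlim : Tendsto (fun R : ℝ => max M ((R - 1) ^ (-ε) * b)) atTop (𝓝 (max M (0 * b))) :=
    tendsto_const_nhds.max (((tendsto_rpow_neg_atTop hε).comp
      (tendsto_atTop_add_const_right _ (-1) tendsto_id)).mul_const b)
  rw [zero_mul, max_eq_left hM₀] at hlim
  refine ge_of_tendsto hlim ?_
  filter_upwards [eventually_gt_atTop 1, eventually_gt_atTop ‖z‖] with R hR hzR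
  exact hbound R hR hzR

theorem norm_le_of_forall_mem_frontier_norm_le_of_subset_re_pos {f : ℂ → E} {W : Set ℂ} {M b : ℝ}
    (hW : W ⊆ {z | 0 < z.re}) (hf : DiffContOnCl ℂ f W) (hb : ∀ z ∈ W, ‖f z‖ ≤ b)
    (hM : ∀ z ∈ frontier W, ‖f z‖ ≤ M) {z : ℂ} (hz : z ∈ W) : ‖f z‖ ≤ M := by
  have hW_ne : W ≠ univ := fun h => absurd (hW (h ▸ mem_univ 0)) (by simp)
  obtain ⟨w, hw⟩ := nonempty_frontier_iff.2 ⟨⟨z, hz⟩, hW_ne⟩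
  have hM₀ : 0 ≤ M := (norm_nonneg _).trans (hM w hw)
  have hz1 : 1 + z ≠ 0 := fun h => by
    have hre := congrArg Complex.re h
    have hpos : 0 < z.re := hW hz
    simp only [Complex.add_re, Complex.one_re, Complex.zero_re] at hre
    linarith
  have hlim : Tendsto (fun ε : ℝ => ‖1 + z‖ ^ (-ε) * ‖f z‖) (𝓝[>] 0)
      (𝓝 (‖1 + z‖ ^ (-(0 : ℝ)) * ‖f z‖)) := by
    refine Tendsto.mono_left (ContinuousAt.tendsto ?_) nhdsWithin_le_nhds
    exact ((Real.continuousAt_const_rpow (norm_ne_zero_iff.2 hz1)).comp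
      continuous_neg.continuousAt).mul_const _
  rw [neg_zero, Real.rpow_zero, one_mul] at hlim
  refine le_of_tendsto hlim (eventually_mem_nhdsWithin.mono fun ε hε => ?_)
  simpa only [norm_smul, Complex.norm_cpow_real] using
    norm_cpow_smul_le_of_forall_mem_frontier_norm_le hW hf hb hM hM₀ hε hz

end HalfPlane

theorem disjoint_frontier_connectedComponentIn {α : Type*} [TopologicalSpace α]
    [LocallyConnectedSpace α] {S : Set α} (hS : IsOpen S) (x : α) :
    Disjoint (frontier (connectedComponentIn S x)) S := by
  refine disjoint_left.2 fun z hz hzS => ?_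
  rw [hS.connectedComponentIn.frontier_eq] at hz
  obtain ⟨w, hw_z, hw_x⟩ :=
    mem_closure_iff.1 hz.1 _ hS.connectedComponentIn (mem_connectedComponentIn hzS)
  refine hz.2 ?_
  rw [connectedComponentIn_eq hw_x, ← connectedComponentIn_eq hw_z]
  exact mem_connectedComponentIn hzS

section SuperlevelQuadrant

variable {E : Type*} [NormedAddCommGroup E]

/-- The part of the open first quadrant on which the norm of `G` exceeds `M`. -/
def superlevelQuadrant (G : ℂ → E) (M : ℝ) : Set ℂ :=
  {z | 0 < z.re ∧ 0 < z.im ∧ M < ‖G z‖}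

variable {G : ℂ → E} {M b : ℝ} {p : ℂ}

theorem isOpen_superlevelQuadrant (hG : ContinuousOn G {z | 0 < z.re}) :
    IsOpen (superlevelQuadrant G M) := by
  have hopen : IsOpen ({z : ℂ | 0 < z.re} ∩ (fun z => ‖G z‖) ⁻¹' Ioi M) :=
    hG.norm.isOpen_inter_preimage isOpen_setOf_re_pos isOpen_Ioi
  have heq : superlevelQuadrant G M =
      {z : ℂ | 0 < z.im} ∩ ({z : ℂ | 0 < z.re} ∩ (fun z => ‖G z‖) ⁻¹' Ioi M) :=
    Set.ext fun _ => and_left_comm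
  rw [heq]
  exact (isOpen_lt continuous_const Complex.continuous_im).inter hopen

theorem closure_connectedComponentIn_superlevelQuadrant_subset :
    closure (connectedComponentIn (superlevelQuadrant G M) p) ⊆ {z | 0 ≤ z.re ∧ 0 ≤ z.im} := by
  refine closure_minimal (fun z hz => ?_) ?_
  · obtain ⟨hre, him, -⟩ := connectedComponentIn_subset _ _ hz
    exact ⟨hre.le, him.le⟩
  · exact (isClosed_le continuous_const Complex.continuous_re).inter
      (isClosed_le continuous_const Complex.continuous_im)

/-- Otherwise the component would have `‖G‖ ≤ M` on its whole boundary, contradicting the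
Phragmén–Lindelöf principle. -/
theorem exists_mem_closure_connectedComponentIn_superlevelQuadrant [NormedSpace ℂ E]
    (hG : DiffContOnCl ℂ G {z | 0 < z.re}) (hb : ∀ z : ℂ, 0 < z.re → ‖G z‖ ≤ b)
    (hM : ∀ x : ℝ, 0 ≤ x → ‖G x‖ ≤ M) (hp : p ∈ superlevelQuadrant G M) :
    ∃ q ∈ closure (connectedComponentIn (superlevelQuadrant G M) p),
      q.re = 0 ∧ 0 < q.im ∧ M < ‖G q‖ := by
  set W := connectedComponentIn (superlevelQuadrant G M) p
  have hWS : W ⊆ superlevelQuadrant G M := connectedComponentIn_subset _ p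
  by_contra! hcon
  refine hp.2.2.not_ge (norm_le_of_forall_mem_frontier_norm_le_of_subset_re_pos (b := b)
    (fun z hz => (hWS hz).1) (hG.mono fun z hz => (hWS hz).1) (fun z hz => hb z (hWS hz).1)
    (fun z hz => ?_) (mem_connectedComponentIn hp))
  obtain ⟨hre, him⟩ :=
    closure_connectedComponentIn_superlevelQuadrant_subset (frontier_subset_closure hz)
  rcases him.eq_or_lt with him | him
  · have hz_real : (z.re : ℂ) = z := Complex.ext rfl him
    exact hz_real ▸ hM _ hre
  rcases hre.eq_or_lt with hre | hre
  · exact hcon z (frontier_subset_closure hz) hre.symm him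
  · by_contra! hlt
    exact (disjoint_frontier_connectedComponentIn
      (isOpen_superlevelQuadrant hG.differentiableOn.continuousOn) p).le_bot ⟨hz, hre, him, hlt⟩

theorem exists_ball_subset_connectedComponentIn_superlevelQuadrant
    (hG : ContinuousOn G {z | 0 ≤ z.re}) {q : ℂ}
    (hq : q ∈ closure (connectedComponentIn (superlevelQuadrant G M) p))
    (him : 0 < q.im) (hlt : M < ‖G q‖) :
    ∃ ρ κ : ℝ, 0 < ρ ∧ 0 < κ ∧ ∀ z ∈ Metric.ball q ρ, 0 < z.re →
      z ∈ connectedComponentIn (superlevelQuadrant G M) p ∧ κ ≤ ‖G z‖ - M := by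
  have hqre := (closure_connectedComponentIn_superlevelQuadrant_subset hq).1
  obtain ⟨κ, hκ, hκq⟩ := exists_between (sub_pos.2 hlt)
  have hnear : ∀ᶠ z in 𝓝[{z | 0 ≤ z.re}] q, κ < ‖G z‖ - M ∧ 0 < z.im :=
    (((hG q hqre).norm.sub_const M).eventually_const_lt hκq).and
      ((Complex.continuous_im.continuousAt.eventually_const_lt him).filter_mono nhdsWithin_le_nhds)
  obtain ⟨ρ, hρ, hball⟩ := Metric.mem_nhdsWithin_iff.1 hnear
  have hhalf : Metric.ball q ρ ∩ {z | 0 < z.re} ⊆ superlevelQuadrant G M := by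
    rintro z ⟨hzq, hzre : 0 < z.re⟩
    obtain ⟨hκz, hzim⟩ := hball ⟨hzq, hzre.le⟩
    exact ⟨hzre, hzim, by linarith⟩
  obtain ⟨w, hwW, hwq⟩ := Metric.mem_closure_iff.1 hq ρ hρ
  have hw : w ∈ Metric.ball q ρ ∩ {z | 0 < z.re} :=
    ⟨by rwa [Metric.mem_ball'], (connectedComponentIn_subset _ _ hwW).1⟩
  refine ⟨ρ, κ, hρ, hκ, fun z hz hzre => ⟨?_, (hball ⟨hz, hzre.le⟩).1.le⟩⟩
  rw [connectedComponentIn_eq hwW]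
  exact ((convex_ball q ρ).inter (convex_halfSpace_re_gt 0)).isPreconnected
    |>.subset_connectedComponentIn hw hhalf ⟨hz, hzre⟩

end SuperlevelQuadrant

theorem exists_im_pos_re_mul_pow_pos {a : ℝ} (ha : a ≠ 0) {n : ℕ} (hn : n ≠ 0) :
    ∃ ω : ℂ, 0 < ω.im ∧ 0 < a * (ω ^ n).re := by
  have hn₁ : (1 : ℝ) ≤ n := by exact_mod_cast Nat.one_le_iff_ne_zero.2 hn
  have hn₀ : (0 : ℝ) < n := by linarith
  have hπ := Real.pi_pos
  suffices h : ∃ θ : ℝ, 0 < θ ∧ θ < Real.pi ∧ 0 < a * Real.cos θ by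
    obtain ⟨θ, hθ₀, hθπ, hθ⟩ := h
    refine ⟨Complex.exp ((θ / n : ℝ) * Complex.I), ?_, ?_⟩
    · rw [Complex.exp_ofReal_mul_I_im]
      exact Real.sin_pos_of_pos_of_lt_pi (by positivity)
        (lt_of_le_of_lt (div_le_self hθ₀.le hn₁) hθπ)
    · rwa [← Complex.exp_nat_mul, ← mul_assoc, ← Complex.ofReal_natCast, ← Complex.ofReal_mul,
        mul_div_cancel₀ _ hn₀.ne', Complex.exp_ofReal_mul_I_re]
  rcases lt_or_gt_of_ne ha with h | h
  · exact ⟨3 * Real.pi / 4, by positivity, by linarith, mul_pos_of_neg_of_neg h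
      (Real.cos_neg_of_pi_div_two_lt_of_lt (by linarith) (by linarith))⟩
  · exact ⟨Real.pi / 4, by positivity, by linarith,
      mul_pos h (Real.cos_pos_of_mem_Ioo ⟨by linarith, by linarith⟩)⟩

theorem im_eq_zero_of_eventuallyEq_pow_mul {G g : ℂ → ℂ} {x₀ : ℝ} {n : ℕ}
    (hg : ContinuousAt g x₀) (hGg : ∀ᶠ z in 𝓝 (x₀ : ℂ), G z - G x₀ = (z - x₀) ^ n * g z)
    (hreal : ∀ᶠ t : ℝ in 𝓝 x₀, (G t).im = 0) : (g x₀).im = 0 := by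
  have hcont : ContinuousAt (fun t : ℝ => (g t).im) x₀ :=
    Complex.continuous_im.continuousAt.comp (hg.comp (f := fun t : ℝ => (t : ℂ))
      Complex.continuous_ofReal.continuousAt)
  refine tendsto_nhds_unique (hcont.tendsto.mono_left nhdsWithin_le_nhds)
    (Tendsto.congr' ?_ (tendsto_const_nhds (f := 𝓝[≠] x₀)))
  filter_upwards [hreal.filter_mono nhdsWithin_le_nhds,
    (Complex.continuous_ofReal.continuousAt.eventually hGg).filter_mono nhdsWithin_le_nhds,
    self_mem_nhdsWithin] with t ht hfac hne
  have him := congrArg Complex.im hfac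
  rw [← Complex.ofReal_sub, ← Complex.ofReal_pow, Complex.im_ofReal_mul, Complex.sub_im, ht,
    hreal.self_of_nhds, sub_zero, eq_comm, mul_eq_zero] at him
  exact (him.resolve_left (pow_ne_zero _ (sub_ne_zero.2 hne))).symm

theorem exists_direction_re_growth {G : ℂ → ℂ} {x₀ : ℝ} (hG : AnalyticAt ℂ G x₀)
    (hreal : ∀ᶠ t : ℝ in 𝓝 x₀, (G t).im = 0) (hne : ¬ ∀ᶠ z in 𝓝 (x₀ : ℂ), G z = G x₀) :
    ∃ (n : ℕ) (ω : ℂ) (c : ℝ), n ≠ 0 ∧ 0 < ω.im ∧ 0 < c ∧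
      ∀ᶠ r : ℝ in 𝓝[≥] 0, (G x₀).re + c * r ^ n ≤ (G (x₀ + r * ω)).re := by
  obtain ⟨n, g, hg, hg₀, hGg⟩ :=
    (hG.sub analyticAt_const).exists_eventuallyEq_pow_smul_nonzero_iff.2
      (by simpa [sub_eq_zero] using hne)
  simp only [Pi.sub_apply, smul_eq_mul] at hGg
  have hn : n ≠ 0 := by
    rintro rfl
    exact hg₀ (by simpa using hGg.self_of_nhds.symm)
  have him : (g x₀).im = 0 := im_eq_zero_of_eventuallyEq_pow_mul hg.continuousAt hGg hreal
  obtain ⟨ω, hω, hpos⟩ :=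
    exists_im_pos_re_mul_pow_pos (fun hre => hg₀ (Complex.ext hre him)) hn
  have hpos' : 0 < (ω ^ n * g x₀).re := by rwa [Complex.mul_re, him, mul_zero, sub_zero, mul_comm]
  obtain ⟨c, hc, hc'⟩ := exists_between hpos'
  have hray : Tendsto (fun r : ℝ => (x₀ + r * ω : ℂ)) (𝓝 0) (𝓝 x₀) := by
    have hcont : Continuous fun r : ℝ => (x₀ + r * ω : ℂ) := by fun_prop
    simpa using hcont.tendsto 0
  have hlim : Tendsto (fun r : ℝ => (ω ^ n * g (x₀ + r * ω)).re) (𝓝 0) (𝓝 (ω ^ n * g x₀).re) :=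
    (Complex.continuous_re.tendsto _).comp ((hg.continuousAt.tendsto.comp hray).const_mul _)
  refine ⟨n, ω, c, hn, hω, hc, ?_⟩
  filter_upwards [(hlim.eventually_const_lt hc').filter_mono nhdsWithin_le_nhds,
    (hray.eventually hGg).filter_mono nhdsWithin_le_nhds, self_mem_nhdsWithin] with r hlt hfac hr
  have hre := congrArg Complex.re hfac
  rw [add_sub_cancel_left, mul_pow, mul_assoc, ← Complex.ofReal_pow, Complex.re_ofReal_mul,
    Complex.sub_re] at hre
  have := mul_le_mul_of_nonneg_left hlt.le (pow_nonneg hr n)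
  linarith

section BoundedIncrements

/-- A family `Φ` of complex functions is uniformly bounded near the point `z`. -/
def IsBoundedNear (Φ : Set (ℂ → ℂ)) (z : ℂ) : Prop :=
  ∃ B : ℝ, ∀ᶠ w in 𝓝 z, ∀ φ ∈ Φ, ‖φ w‖ ≤ B

/-- The primitives on `D` of the members of `Φ` have uniformly bounded increments from `u` to `v`.
For holomorphic `Φ` and a path in `D` this is a uniform bound of the integrals along the path. -/
def HasBoundedIncrements (D : Set ℂ) (Φ : Set (ℂ → ℂ)) (u v : ℂ) : Prop :=
  ∃ K : ℝ, ∀ φ ∈ Φ, ∀ Ψ : ℂ → ℂ, (∀ z ∈ D, HasDerivAt Ψ (φ z) z) → ‖Ψ v - Ψ u‖ ≤ K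

theorem isBoundedNear_of_continuousAt {Φ : Set (ℂ → ℂ)} {z : ℂ} {β : ℂ → ℝ}
    (hβ : ContinuousAt β z) (h : ∀ᶠ w in 𝓝 z, ∀ φ ∈ Φ, ‖φ w‖ ≤ β w) : IsBoundedNear Φ z := by
  refine ⟨β z + 1, ?_⟩
  filter_upwards [h, hβ.eventually_lt_const (lt_add_one _)] with w hw hβw φ hφ
  exact (hw φ hφ).trans hβw.le

namespace HasBoundedIncrements

variable {D W : Set ℂ} {Φ : Set (ℂ → ℂ)} {u v w : ℂ}

theorem symm (h : HasBoundedIncrements D Φ u v) : HasBoundedIncrements D Φ v u := by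
  obtain ⟨K, hK⟩ := h
  exact ⟨K, fun φ hφ Ψ hΨ => norm_sub_rev (Ψ u) (Ψ v) ▸ hK φ hφ Ψ hΨ⟩

theorem trans (huv : HasBoundedIncrements D Φ u v) (hvw : HasBoundedIncrements D Φ v w) :
    HasBoundedIncrements D Φ u w := by
  obtain ⟨K, hK⟩ := huv
  obtain ⟨L, hL⟩ := hvw
  exact ⟨L + K, fun φ hφ Ψ hΨ => (norm_sub_le_norm_sub_add_norm_sub _ (Ψ v) _).trans
    (add_le_add (hL φ hφ Ψ hΨ) (hK φ hφ Ψ hΨ))⟩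

theorem of_convex (hW : Convex ℝ W) (hWD : W ⊆ D) {B : ℝ} (hB : ∀ z ∈ W, ∀ φ ∈ Φ, ‖φ z‖ ≤ B)
    (hu : u ∈ W) (hv : v ∈ W) : HasBoundedIncrements D Φ u v :=
  ⟨B * ‖v - u‖, fun φ hφ _ hΨ => hW.norm_image_sub_le_of_norm_hasDerivWithin_le
    (fun z hz => (hΨ z (hWD hz)).hasDerivWithinAt) (fun z hz => hB z hz φ hφ) hu hv⟩

theorem of_isPreconnected (hW : IsOpen W) (hWc : IsPreconnected W) (hWD : W ⊆ D)
    (hB : ∀ z ∈ W, IsBoundedNear Φ z) (hu : u ∈ W) (hv : v ∈ W) :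
    HasBoundedIncrements D Φ u v := by
  refine hWc.induction₂ (HasBoundedIncrements D Φ) (fun z hz => ?_)
    (fun _ _ _ _ _ _ => trans) (fun _ _ _ _ => symm) hu hv
  obtain ⟨B, hB⟩ := hB z hz
  obtain ⟨r, hr, hball⟩ := Metric.eventually_nhds_iff_ball.1 (hB.and (hW.mem_nhds hz))
  refine Eventually.filter_mono nhdsWithin_le_nhds ?_
  filter_upwards [Metric.ball_mem_nhds z hr] with w hw
  exact of_convex (convex_ball z r) (fun y hy => hWD (hball y hy).2) (fun y hy => (hball y hy).1)
    (Metric.mem_ball_self hr) hw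

end HasBoundedIncrements

end BoundedIncrements

section RealOnRealAxis

variable {g : ℂ → ℂ}

theorem im_dslope_zero_ofReal (hg : Differentiable ℂ g) (hreal : ∀ t : ℝ, (g t).im = 0) (t : ℝ) :
    (dslope g 0 t).im = 0 := by
  have hcont : Continuous (dslope g 0) := continuous_iff_continuousAt.2 fun z => by
    rcases eq_or_ne z 0 with rfl | hz
    · exact continuousAt_dslope_same.2 (hg 0)
    · exact (continuousAt_dslope_of_ne hz).2 (hg z).continuousAt
  have hcont' : Continuous fun t : ℝ => (dslope g 0 t).im :=
    Complex.continuous_im.comp (hcont.comp Complex.continuous_ofReal)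
  refine congrFun (hcont'.ext_on (dense_compl_singleton (0 : ℝ)) continuous_const
    (g := fun _ => 0) fun s hs => ?_) t
  have hs' : (s : ℂ) ≠ 0 := Complex.ofReal_ne_zero.2 hs
  beta_reduce
  rw [dslope_of_ne _ hs', slope_def_module, sub_zero, smul_eq_mul, ← Complex.ofReal_inv,
    Complex.im_ofReal_mul, Complex.sub_im, hreal, ← Complex.ofReal_zero, hreal, sub_zero, mul_zero]

theorem exists_primitive_im_ofReal_eq (hg : Differentiable ℂ g) (hreal : ∀ t : ℝ, (g t).im = 0) :
    ∃ Φ : ℂ → ℂ, (∀ z, HasDerivAt Φ (g z) z) ∧ ∀ s t : ℝ, (Φ s).im = (Φ t).im := by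
  obtain ⟨Φ, hΦ⟩ := hg.isExactOn_univ
  refine ⟨Φ, fun z => hΦ z (mem_univ z), ?_⟩
  have hderiv : ∀ t : ℝ, HasDerivAt (fun t : ℝ => (Φ t).im) 0 t := fun t => by
    simpa [hreal t] using!
      Complex.imCLM.hasFDerivAt.comp_hasDerivAt t (hΦ t (mem_univ _)).comp_ofReal
  exact is_const_of_deriv_eq_zero (fun t => (hderiv t).differentiableAt) fun t => (hderiv t).deriv

/-- The complement of the closed negative imaginary axis, on which `z ↦ log (-I * z)` is a branch
of the logarithm whose imaginary part increases by `π` from the positive to the negative reals. -/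
def lowerSlitPlane : Set ℂ :=
  {z | -Complex.I * z ∈ Complex.slitPlane}

theorem mem_lowerSlitPlane_iff {z : ℂ} : z ∈ lowerSlitPlane ↔ 0 < z.im ∨ z.re ≠ 0 := by
  simp [lowerSlitPlane, Complex.mem_slitPlane_iff]

theorem hasDerivAt_log_neg_I_mul {z : ℂ} (hz : z ∈ lowerSlitPlane) :
    HasDerivAt (fun z => Complex.log (-Complex.I * z)) z⁻¹ z := by
  have hlog := ((hasDerivAt_id z).const_mul (-Complex.I)).clog hz
  simp only [id, mul_one] at hlog
  rwa [div_mul_cancel_left₀ (neg_ne_zero.2 Complex.I_ne_zero)] at hlog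

/-- Subtracting `g 0 * log (-I * z)` leaves a primitive of `dslope g 0`, which is real on `ℝ`. -/
theorem exists_primitive_div_id (hg : Differentiable ℂ g) (hreal : ∀ t : ℝ, (g t).im = 0) :
    ∃ Ψ : ℂ → ℂ, (∀ z ∈ lowerSlitPlane, HasDerivAt Ψ (g z / z) z) ∧
      ∀ x y : ℝ, 0 < x → 0 < y → (Ψ (-y) - Ψ x).im = (g 0).re * Real.pi := by
  have hdslope : Differentiable ℂ (dslope g 0) := by
    rw [← differentiableOn_univ, Complex.differentiableOn_dslope univ_mem]
    exact hg.differentiableOn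
  obtain ⟨Φ, hΦ, hΦim⟩ := exists_primitive_im_ofReal_eq hdslope (im_dslope_zero_ofReal hg hreal)
  refine ⟨fun z => Φ z + g 0 * Complex.log (-Complex.I * z), fun z hz => ?_, fun x y hx hy => ?_⟩
  · have hz₀ : z ≠ 0 := by
      rintro rfl
      simp [mem_lowerSlitPlane_iff] at hz
    convert! (hΦ z).add ((hasDerivAt_log_neg_I_mul hz).const_mul (g 0)) using 1
    rw [dslope_of_ne _ hz₀, slope_def_field]
    field_simp
    ring
  · have hlog_x : (Complex.log (-Complex.I * x)).im = -(Real.pi / 2) := by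
      rw [Complex.log_im, mul_comm, Complex.arg_real_mul _ hx, Complex.arg_neg_I]
    have hlog_y : (Complex.log (-Complex.I * -y)).im = Real.pi / 2 := by
      rw [Complex.log_im, neg_mul_neg, mul_comm, Complex.arg_real_mul _ hy, Complex.arg_I]
    have hg₀ : (g 0).im = 0 := by exact_mod_cast hreal 0
    have hΦ_xy : (Φ (-y)).im = (Φ x).im := by simpa using hΦim (-y) x
    simp only [Complex.sub_im, Complex.add_im, Complex.mul_im, hlog_x, hlog_y, hg₀, hΦ_xy]
    ring

end RealOnRealAxis

section ConjReflect

/-- The reflection `z ↦ conj (f (conj z))` of `f` in the real axis. -/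
noncomputable def conjReflect (f : ℂ → ℂ) (z : ℂ) : ℂ :=
  conj (f (conj z))

/-- The quotients `f * conjReflect f / z`, `f ∈ 𝓐`. The numerators are real on the real axis, and
their residue at the origin is `‖f 0‖ ^ 2`. -/
def reflectQuotients (𝓐 : Set (ℂ → ℂ)) : Set (ℂ → ℂ) :=
  (fun f z => f z * conjReflect f z / z) '' 𝓐

variable {f : ℂ → ℂ} {𝓐 : Set (ℂ → ℂ)}

theorem norm_conjReflect (f : ℂ → ℂ) (z : ℂ) : ‖conjReflect f z‖ = ‖f (conj z)‖ :=
  RCLike.norm_conj _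

theorem differentiable_conjReflect (hf : Differentiable ℂ f) :
    Differentiable ℂ (conjReflect f) := fun z => by
  have h := (hf (conj z)).conj_conj
  rwa [Complex.conj_conj] at h

theorem mul_conjReflect_ofReal (f : ℂ → ℂ) (t : ℝ) :
    f t * conjReflect f t = ((‖f t‖ ^ 2 : ℝ) : ℂ) := by
  rw [conjReflect, Complex.conj_ofReal, Complex.mul_conj, Complex.normSq_eq_norm_sq]

theorem norm_le_of_mem_reflectQuotients (h𝓐 : ∀ f ∈ 𝓐, conjReflect f ∈ 𝓐) {z : ℂ} {B : ℝ}
    (hB : ∀ f ∈ 𝓐, ‖f z‖ ≤ B) : ∀ φ ∈ reflectQuotients 𝓐, ‖φ z‖ ≤ B ^ 2 / ‖z‖ := by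
  rintro _ ⟨f, hf, rfl⟩
  have hB₀ : 0 ≤ B := (norm_nonneg _).trans (hB f hf)
  rw [norm_div, norm_mul, pow_two]
  gcongr
  exacts [hB f hf, hB _ (h𝓐 f hf)]

theorem IsBoundedNear.reflectQuotients (h𝓐 : ∀ f ∈ 𝓐, conjReflect f ∈ 𝓐) {z : ℂ} (hz : z ≠ 0)
    (h : IsBoundedNear 𝓐 z) : IsBoundedNear (reflectQuotients 𝓐) z := by
  obtain ⟨B, hB⟩ := h
  have hcont : ContinuousAt (fun w : ℂ => B ^ 2 / ‖w‖) z :=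
    continuousAt_const.div continuous_norm.continuousAt (norm_ne_zero_iff.2 hz)
  exact isBoundedNear_of_continuousAt hcont
    (hB.mono fun _ hw => norm_le_of_mem_reflectQuotients h𝓐 hw)

theorem exists_norm_apply_zero_le_of_hasBoundedIncrements (hd : ∀ f ∈ 𝓐, Differentiable ℂ f)
    {x y : ℝ} (hx : 0 < x) (hy : 0 < y)
    (h : HasBoundedIncrements lowerSlitPlane (reflectQuotients 𝓐) x (-y)) :
    ∃ K : ℝ, ∀ f ∈ 𝓐, ‖f 0‖ ≤ K := by
  obtain ⟨K, hK⟩ := h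
  refine ⟨√(K / Real.pi), fun f hf => Real.le_sqrt_of_sq_le ?_⟩
  have hreal : ∀ t : ℝ, ((f * conjReflect f) t).im = 0 := fun t => by
    rw [Pi.mul_apply, mul_conjReflect_ofReal, Complex.ofReal_im]
  obtain ⟨Ψ, hΨ, him⟩ :=
    exists_primitive_div_id ((hd f hf).mul (differentiable_conjReflect (hd f hf))) hreal
  have h₀ := mul_conjReflect_ofReal f 0
  rw [Complex.ofReal_zero] at h₀
  rw [le_div_iff₀ Real.pi_pos]
  calc ‖f 0‖ ^ 2 * Real.pi = (Ψ (-y) - Ψ x).im := by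
        rw [him x y hx hy, Pi.mul_apply, h₀, Complex.ofReal_re]
    _ ≤ ‖Ψ (-y) - Ψ x‖ := (le_abs_self _).trans (Complex.abs_im_le_norm _)
    _ ≤ K := hK _ ⟨f, hf, rfl⟩ Ψ hΨ

end ConjReflect

section ControlledFamily

theorem norm_one_add_sq_of_norm_eq_one {u : ℂ} (hu : ‖u‖ = 1) : ‖1 + u ^ 2‖ = 2 * |u.re| := by
  have hu_conj : conj u * u = 1 := by simp [Complex.conj_mul', hu]
  rw [← hu_conj, pow_two, ← add_mul, norm_mul, hu, mul_one, add_comm, Complex.add_conj,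
    Complex.norm_real, Real.norm_eq_abs, abs_mul, abs_two]

/-- The factor `1 + ((z - q) / r) ^ 2` absorbs `(z - q).re`, as it has modulus
`2 * |(z - q).re| / r` on the circle. -/
theorem norm_le_of_forall_mem_sphere_norm_mul_abs_re_le {f : ℂ → ℂ} {q : ℂ} {r C : ℝ}
    (hr : 0 < r) (hf : DiffContOnCl ℂ f (Metric.ball q r))
    (hC : ∀ z ∈ Metric.sphere q r, ‖f z‖ * |(z - q).re| ≤ C) {z : ℂ}
    (hz : z ∈ Metric.ball q (r / 2)) : ‖f z‖ ≤ 8 * C / (3 * r) := by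
  have hnorm : ∀ w : ℂ, ‖(w - q) / r‖ = dist w q / r := fun w => by
    rw [norm_div, ← dist_eq_norm, Complex.norm_real, Real.norm_of_nonneg hr.le]
  have hupper : ‖(1 + ((z - q) / r) ^ 2) * f z‖ ≤ 2 * C / r := by
    refine Complex.norm_le_of_forall_mem_frontier_norm_le Metric.isBounded_ball
      (f := fun z => (1 + ((z - q) / r) ^ 2) * f z)
      ((Differentiable.diffContOnCl (f := fun z => 1 + ((z - q) / r) ^ 2) (by fun_prop)).smul hf)
      (fun w hw => ?_)
      (subset_closure (Metric.ball_subset_ball (half_le_self hr.le) hz))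
    rw [frontier_ball _ hr.ne'] at hw
    have hw₁ : ‖(w - q) / r‖ = 1 := by rw [hnorm, Metric.mem_sphere.1 hw, div_self hr.ne']
    rw [norm_mul, norm_one_add_sq_of_norm_eq_one hw₁, Complex.div_ofReal_re, abs_div,
      abs_of_pos hr, mul_div_assoc', div_mul_eq_mul_div, mul_assoc, mul_comm |_|]
    gcongr
    exact hC w hw
  have hlower : 3 / 4 ≤ ‖1 + ((z - q) / r) ^ 2‖ := by
    have hz₂ : ‖(z - q) / r‖ ≤ 1 / 2 := by
      rw [hnorm, div_le_iff₀ hr]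
      linarith [Metric.mem_ball.1 hz]
    have hsub := norm_sub_norm_le (1 : ℂ) (-((z - q) / r) ^ 2)
    rw [sub_neg_eq_add, norm_neg, norm_pow, norm_one] at hsub
    nlinarith [norm_nonneg ((z - q) / r)]
  have h := (mul_le_mul_of_nonneg_right hlower (norm_nonneg _)).trans (norm_mul _ (f z) ▸ hupper)
  rw [le_div_iff₀ hr] at h
  rw [le_div_iff₀ (by positivity)]
  linarith

/-- The entire functions `f` with `‖f z‖ ≤ C / -z.re` on the left half-plane and
`‖f z‖ ≤ C / (z.re * (‖G z‖ - M))` on the part of the right half-plane where `M < ‖G z‖`. -/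
def controlledFamily (G : ℂ → ℂ) (M C : ℝ) : Set (ℂ → ℂ) :=
  {f | Differentiable ℂ f ∧ (∀ z, z.re < 0 → ‖f z‖ ≤ C / -z.re) ∧
    ∀ z, 0 < z.re → M < ‖G z‖ → ‖f z‖ ≤ C / (z.re * (‖G z‖ - M))}

variable {G : ℂ → ℂ} {M C : ℝ}

theorem conjReflect_mem_controlledFamily
    (hconj : ∀ z : ℂ, 0 < z.re → ‖G (conj z)‖ = ‖G z‖) {f : ℂ → ℂ}
    (hf : f ∈ controlledFamily G M C) : conjReflect f ∈ controlledFamily G M C := by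
  obtain ⟨hd, hneg, hpos⟩ := hf
  refine ⟨differentiable_conjReflect hd, fun z hz => ?_, fun z hz hlt => ?_⟩
  · rw [norm_conjReflect]
    exact hneg (conj z) hz
  · rw [norm_conjReflect, ← hconj z hz]
    exact hpos (conj z) hz (hconj z hz ▸ hlt)

theorem isBoundedNear_controlledFamily_of_re_neg {z : ℂ} (hz : z.re < 0) :
    IsBoundedNear (controlledFamily G M C) z := by
  refine isBoundedNear_of_continuousAt (β := fun w => C / -w.re)
    (continuousAt_const.div Complex.continuous_re.continuousAt.neg (neg_ne_zero.2 hz.ne)) ?_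
  filter_upwards [Complex.continuous_re.continuousAt.eventually_lt_const hz] with w hw f hf
  exact hf.2.1 w hw

theorem isBoundedNear_controlledFamily_of_lt_norm (hG : ContinuousOn G {z | 0 < z.re}) {z : ℂ}
    (hz : 0 < z.re) (hlt : M < ‖G z‖) : IsBoundedNear (controlledFamily G M C) z := by
  have hGz : ContinuousAt (fun w => ‖G w‖) z :=
    (hG.continuousAt (isOpen_setOf_re_pos.mem_nhds hz)).norm
  refine isBoundedNear_of_continuousAt (β := fun w => C / (w.re * (‖G w‖ - M)))
    (continuousAt_const.div (Complex.continuous_re.continuousAt.mul (hGz.sub continuousAt_const))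
      (mul_pos hz (sub_pos.2 hlt)).ne') ?_
  filter_upwards [Complex.continuous_re.continuousAt.eventually_const_lt hz,
    hGz.eventually_const_lt hlt] with w hw hltw f hf
  exact hf.2.2 w hw hltw

theorem norm_le_of_mem_controlledFamily_of_mem_ball {q : ℂ} (hq : q.re = 0) {ρ κ : ℝ}
    (hρ : 0 < ρ) (hκ : 0 < κ) (h : ∀ z ∈ Metric.ball q ρ, 0 < z.re → κ ≤ ‖G z‖ - M) {f : ℂ → ℂ}
    (hf : f ∈ controlledFamily G M C) {z : ℂ} (hz : z ∈ Metric.ball q (ρ / 4)) :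
    ‖f z‖ ≤ 8 * max C (C / κ) / (3 * (ρ / 2)) := by
  obtain ⟨hd, hneg, hpos⟩ := hf
  have hC : 0 ≤ C := by simpa using (norm_nonneg _).trans (hneg (-1) (by simp))
  refine norm_le_of_forall_mem_sphere_norm_mul_abs_re_le (half_pos hρ) hd.diffContOnCl
    (fun w hw => ?_) (by rwa [show ρ / 2 / 2 = ρ / 4 by ring])
  rw [Complex.sub_re, hq, sub_zero]
  rcases lt_trichotomy w.re 0 with hre | hre | hre
  · rw [abs_of_neg hre, ← le_div_iff₀ (neg_pos.2 hre)]
    exact (hneg w hre).trans (by gcongr; exacts [(neg_pos.2 hre).le, le_max_left _ _])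
  · rw [hre, abs_zero, mul_zero]
    exact le_max_of_le_left hC
  · have hκw : κ ≤ ‖G w‖ - M :=
      h w (Metric.closedBall_subset_ball (half_lt_self hρ) (Metric.sphere_subset_closedBall hw)) hre
    rw [abs_of_pos hre, ← le_div_iff₀ hre]
    calc ‖f w‖ ≤ C / (w.re * (‖G w‖ - M)) := hpos w hre (by linarith)
      _ ≤ C / (w.re * κ) := by gcongr
      _ = C / κ / w.re := by rw [mul_comm, div_div]
      _ ≤ max C (C / κ) / w.re := by gcongr; exact le_max_right _ _

/-- `U` is the union of a component of the superlevel set, a disc about a point of the imaginary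
axis which that component reaches, and the left half-plane. -/
theorem exists_isPreconnected_isBoundedNear_controlledFamily {b : ℝ} (C : ℝ)
    (hG : DiffContOnCl ℂ G {z | 0 < z.re}) (hb : ∀ z : ℂ, 0 < z.re → ‖G z‖ ≤ b)
    (hM : ∀ x : ℝ, 0 ≤ x → ‖G x‖ ≤ M) {p : ℂ} (hp : p ∈ superlevelQuadrant G M) :
    ∃ U : Set ℂ, IsOpen U ∧ IsPreconnected U ∧ U ⊆ lowerSlitPlane ∧ p ∈ U ∧ -1 ∈ U ∧
      ∀ z ∈ U, IsBoundedNear (controlledFamily G M C) z := by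
  have hGc : ContinuousOn G {z | 0 ≤ z.re} := Complex.closure_setOfPred_lt_re 0 ▸ hG.continuousOn
  have hGo := hG.differentiableOn.continuousOn
  obtain ⟨q, hq, hre, him, hlt⟩ :=
    exists_mem_closure_connectedComponentIn_superlevelQuadrant hG hb hM hp
  obtain ⟨ρ, κ, hρ, hκ, hball⟩ :=
    exists_ball_subset_connectedComponentIn_superlevelQuadrant hGc hq him hlt
  set W := connectedComponentIn (superlevelQuadrant G M) p
  have hWS : W ⊆ superlevelQuadrant G M := connectedComponentIn_subset _ p
  set δ := min (ρ / 4) q.im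
  have hδ₀ : 0 < δ := lt_min (by positivity) him
  have hmem : ∀ t : ℝ, |t| < δ → q + t ∈ Metric.ball q δ := fun t ht => by simpa using ht
  have hδ₂ : |δ / 2| < δ := by rw [abs_of_pos (half_pos hδ₀)]; exact half_lt_self hδ₀
  have hδρ : δ ≤ ρ / 4 := min_le_left _ _
  refine ⟨W ∪ Metric.ball q δ ∪ {z | z.re < 0}, ?_, ?_, ?_, ?_, ?_, ?_⟩
  · exact ((isOpen_superlevelQuadrant hGo).connectedComponentIn.union Metric.isOpen_ball).union
      (isOpen_lt Complex.continuous_re continuous_const)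
  · refine ((isPreconnected_connectedComponentIn.union (q + (δ / 2 : ℝ)) ?_ (hmem _ hδ₂)
      (convex_ball q δ).isPreconnected).union (q + (-(δ / 2) : ℝ))
      (Or.inr (hmem _ (by rwa [abs_neg]))) ?_ (convex_halfSpace_re_lt 0).isPreconnected)
    · refine (hball _ (Metric.ball_subset_ball (by linarith) (hmem _ hδ₂)) ?_).1
      simpa [hre] using hδ₀
    · simpa [hre] using hδ₀
  · rintro z ((hz | hz) | hz)
    · exact mem_lowerSlitPlane_iff.2 (Or.inl (hWS hz).2.1)
    · have h := (Complex.abs_im_le_norm (z - q)).trans_lt (mem_ball_iff_norm.1 hz)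
      rw [Complex.sub_im] at h
      refine mem_lowerSlitPlane_iff.2 (Or.inl ?_)
      linarith [(abs_lt.1 h).1, min_le_right (ρ / 4) q.im]
    · exact mem_lowerSlitPlane_iff.2 (Or.inr (ne_of_lt hz))
  · exact Or.inl (Or.inl (mem_connectedComponentIn hp))
  · simp
  · rintro z ((hz | hz) | hz)
    · exact isBoundedNear_controlledFamily_of_lt_norm hGo (hWS hz).1 (hWS hz).2.2
    · refine ⟨8 * max C (C / κ) / (3 * (ρ / 2)), ?_⟩
      filter_upwards [Metric.isOpen_ball.mem_nhds hz] with w hw f hf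
      exact norm_le_of_mem_controlledFamily_of_mem_ball hre hρ hκ
        (fun z hz hzre => (hball z hz hzre).2) hf (Metric.ball_subset_ball hδρ hw)
    · exact isBoundedNear_controlledFamily_of_re_neg hz

/-- The family `𝓐` multiplied by `(z - x₀) ^ n`. For suitable `n` this turns a controlled family
into one that is bounded along a ray issuing from a point `x₀` with `‖G x₀‖ = M`. -/
def dampedFamily (x₀ : ℝ) (n : ℕ) (𝓐 : Set (ℂ → ℂ)) : Set (ℂ → ℂ) :=
  (fun f z => (z - x₀) ^ n * f z) '' 𝓐

theorem conjReflect_mem_dampedFamily {𝓐 : Set (ℂ → ℂ)} (h𝓐 : ∀ f ∈ 𝓐, conjReflect f ∈ 𝓐)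
    {x₀ : ℝ} {n : ℕ} {f : ℂ → ℂ} (hf : f ∈ dampedFamily x₀ n 𝓐) :
    conjReflect f ∈ dampedFamily x₀ n 𝓐 := by
  obtain ⟨f, hf, rfl⟩ := hf
  refine ⟨conjReflect f, h𝓐 f hf, funext fun z => ?_⟩
  simp [conjReflect]

theorem IsBoundedNear.dampedFamily {𝓐 : Set (ℂ → ℂ)} {z : ℂ} (h : IsBoundedNear 𝓐 z) (x₀ : ℝ)
    (n : ℕ) : IsBoundedNear (dampedFamily x₀ n 𝓐) z := by
  obtain ⟨B, hB⟩ := h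
  refine isBoundedNear_of_continuousAt (β := fun w => ‖w - x₀‖ ^ n * B) (by fun_prop)
    (hB.mono fun w hw => ?_)
  rintro _ ⟨f, hf, rfl⟩
  rw [norm_mul, norm_pow]
  gcongr
  exact hw f hf

theorem norm_pow_sub_mul_le_of_mem_controlledFamily {x₀ r c : ℝ} {n : ℕ} {ω : ℂ} (hx₀ : 0 < x₀)
    (hn : n ≠ 0) (hc : 0 < c) (hC : 0 ≤ C) (hr : 0 ≤ r) (hre : x₀ / 2 ≤ (x₀ + r * ω).re)
    (hgrow : M + c * r ^ n ≤ ‖G (x₀ + r * ω)‖) {f : ℂ → ℂ} (hf : f ∈ controlledFamily G M C) :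
    ‖(x₀ + r * ω - x₀) ^ n * f (x₀ + r * ω)‖ ≤ ‖ω‖ ^ n * (C / (x₀ / 2 * c)) := by
  rw [add_sub_cancel_left, norm_mul, norm_pow, norm_mul, mul_pow, Complex.norm_real,
    Real.norm_of_nonneg hr, mul_comm (r ^ n), mul_assoc]
  rcases hr.eq_or_lt with rfl | hr
  · rw [zero_pow hn, zero_mul, mul_zero]
    positivity
  · have hre₀ : 0 < (x₀ + r * ω).re := (half_pos hx₀).trans_le hre
    have hgrow' : c * r ^ n ≤ ‖G (x₀ + r * ω)‖ - M := by linarith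
    have hlt : M < ‖G (x₀ + r * ω)‖ := sub_pos.1 (lt_of_lt_of_le (by positivity) hgrow')
    gcongr
    calc r ^ n * ‖f (x₀ + r * ω)‖
        ≤ r ^ n * (C / ((x₀ + r * ω).re * (‖G (x₀ + r * ω)‖ - M))) := by
          gcongr
          exact hf.2.2 _ hre₀ hlt
      _ ≤ r ^ n * (C / (x₀ / 2 * (c * r ^ n))) := by gcongr
      _ = C / (x₀ / 2 * c) := by field_simp

theorem hasBoundedIncrements_dampedFamily_of_ray {x₀ r₁ c : ℝ} {n : ℕ} {ω : ℂ} (hC : 0 ≤ C)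
    (hconj : ∀ z : ℂ, 0 < z.re → ‖G (conj z)‖ = ‖G z‖) (hx₀ : 0 < x₀) (hn : n ≠ 0) (hc : 0 < c)
    (hr₁ : 0 ≤ r₁) (hre : ∀ r ∈ Icc 0 r₁, x₀ / 2 ≤ (x₀ + r * ω).re)
    (hgrow : ∀ r ∈ Icc 0 r₁, M + c * r ^ n ≤ ‖G (x₀ + r * ω)‖) :
    HasBoundedIncrements lowerSlitPlane
      (reflectQuotients (dampedFamily x₀ n (controlledFamily G M C))) x₀ (x₀ + r₁ * ω) := by
  have hray : Convex ℝ ((fun r : ℝ => (x₀ + r * ω : ℂ)) '' Icc 0 r₁) := by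
    rw [← image_image (fun z : ℂ => (x₀ : ℂ) + z) fun r : ℝ => (r * ω : ℂ)]
    exact ((convex_Icc 0 r₁).is_linear_image
      (Complex.ofRealCLM.smulRight ω).toLinearMap.isLinear).translate _
  refine HasBoundedIncrements.of_convex hray
    (B := (‖ω‖ ^ n * (C / (x₀ / 2 * c))) ^ 2 / (x₀ / 2)) ?_ ?_
    ⟨0, left_mem_Icc.2 hr₁, by simp⟩ ⟨r₁, right_mem_Icc.2 hr₁, rfl⟩
  · rintro _ ⟨r, hr, rfl⟩
    exact mem_lowerSlitPlane_iff.2 (Or.inr ((half_pos hx₀).trans_le (hre r hr)).ne')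
  · rintro _ ⟨r, hr, rfl⟩ φ hφ
    refine (norm_le_of_mem_reflectQuotients (B := ‖ω‖ ^ n * (C / (x₀ / 2 * c)))
      (fun _ => conjReflect_mem_dampedFamily fun _ => conjReflect_mem_controlledFamily hconj)
      ?_ φ hφ).trans ?_
    · rintro _ ⟨f, hf, rfl⟩
      exact norm_pow_sub_mul_le_of_mem_controlledFamily hx₀ hn hc hC hr.1 (hre r hr) (hgrow r hr) hf
    · gcongr
      exact (hre r hr).trans (Complex.re_le_norm _)

theorem exists_ray_norm_growth {x₀ : ℝ} (hG : DiffContOnCl ℂ G {z | 0 < z.re})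
    (hconj : ∀ z : ℂ, 0 < z.re → G (conj z) = conj (G z)) (hx₀ : 0 < x₀) (hGx₀ : G x₀ = M)
    (hG₀ : G 0 ≠ M) :
    ∃ (n : ℕ) (ω : ℂ) (c r₁ : ℝ), n ≠ 0 ∧ 0 < ω.im ∧ 0 < c ∧ 0 < r₁ ∧
      ∀ r ∈ Icc 0 r₁, x₀ / 2 ≤ (x₀ + r * ω).re ∧ M + c * r ^ n ≤ ‖G (x₀ + r * ω)‖ := by
  have hreal : ∀ᶠ t : ℝ in 𝓝 x₀, (G t).im = 0 := by
    filter_upwards [lt_mem_nhds hx₀] with t ht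
    exact Complex.conj_eq_iff_im.1 (by simpa using (hconj t (by simpa using ht)).symm)
  have hconst : ¬ ∀ᶠ z in 𝓝 (x₀ : ℂ), G z = G x₀ := fun h => by
    have heq := eqOn_re_nonneg_of_frequently_eq hG diffContOnCl_const (by simpa using hx₀)
      (h.filter_mono nhdsWithin_le_nhds).frequently
    exact hG₀ ((heq (by simp)).trans hGx₀)
  obtain ⟨n, ω, c, hn, hω, hc, hgrow⟩ := exists_direction_re_growth
    (hG.differentiableOn.analyticAt (isOpen_setOf_re_pos.mem_nhds (by simpa using hx₀)))
    hreal hconst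
  have hre : ∀ᶠ r : ℝ in 𝓝[≥] 0, x₀ / 2 < (x₀ + r * ω).re := by
    have hcont : Continuous fun r : ℝ => (x₀ + r * ω).re := by fun_prop
    refine (hcont.continuousAt.eventually_const_lt ?_).filter_mono nhdsWithin_le_nhds
    simpa using half_lt_self hx₀
  obtain ⟨r₁, hr₁, hIcc⟩ := mem_nhdsGE_iff_exists_Icc_subset.1 (hre.and hgrow)
  refine ⟨n, ω, c, r₁, hn, hω, hc, hr₁, fun r hr => ⟨(hIcc hr).1.le, ?_⟩⟩
  have h := (hIcc hr).2.trans (Complex.re_le_norm _)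
  rwa [hGx₀, Complex.ofReal_re] at h

theorem exists_hasBoundedIncrements_dampedFamily {b x₀ : ℝ} (hC : 0 ≤ C)
    (hG : DiffContOnCl ℂ G {z | 0 < z.re}) (hb : ∀ z : ℂ, 0 < z.re → ‖G z‖ ≤ b)
    (hconj : ∀ z : ℂ, 0 < z.re → G (conj z) = conj (G z))
    (hM : ∀ x : ℝ, 0 ≤ x → ‖G x‖ ≤ M) (hx₀ : 0 < x₀) (hGx₀ : G x₀ = M) (hG₀ : G 0 ≠ M) :
    ∃ n : ℕ, HasBoundedIncrements lowerSlitPlane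
      (reflectQuotients (dampedFamily x₀ n (controlledFamily G M C))) x₀ (-1) := by
  obtain ⟨n, ω, c, r₁, hn, hω, hc, hr₁, hray⟩ := exists_ray_norm_growth hG hconj hx₀ hGx₀ hG₀
  have hconj' : ∀ z : ℂ, 0 < z.re → ‖G (conj z)‖ = ‖G z‖ := fun z hz => by
    rw [hconj z hz, RCLike.norm_conj]
  have hp : (x₀ + r₁ * ω : ℂ) ∈ superlevelQuadrant G M := by
    obtain ⟨hre, hgrow⟩ := hray r₁ (right_mem_Icc.2 hr₁.le)
    refine ⟨(half_pos hx₀).trans_le hre, ?_, hgrow.trans_lt' (lt_add_of_pos_right _ ?_)⟩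
    · simpa using mul_pos hr₁ hω
    · positivity
  obtain ⟨U, hU, hUc, hUD, hpU, h1U, hUb⟩ :=
    exists_isPreconnected_isBoundedNear_controlledFamily C hG hb hM hp
  refine ⟨n, (hasBoundedIncrements_dampedFamily_of_ray hC hconj' hx₀ hn hc hr₁.le
    (fun r hr => (hray r hr).1) fun r hr => (hray r hr).2).trans
    (HasBoundedIncrements.of_isPreconnected hU hUc hUD (fun z hz => ?_) hpU h1U)⟩
  have hz₀ : z ≠ 0 := by
    rintro rfl
    simpa [mem_lowerSlitPlane_iff] using hUD hz
  exact ((hUb z hz).dampedFamily x₀ n).reflectQuotients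
    (fun _ => conjReflect_mem_dampedFamily fun _ => conjReflect_mem_controlledFamily hconj') hz₀

theorem exists_norm_apply_zero_le_of_mem_controlledFamily {b x₀ : ℝ} (hC : 0 ≤ C)
    (hG : DiffContOnCl ℂ G {z | 0 < z.re}) (hb : ∀ z : ℂ, 0 < z.re → ‖G z‖ ≤ b)
    (hconj : ∀ z : ℂ, 0 < z.re → G (conj z) = conj (G z))
    (hM : ∀ x : ℝ, 0 ≤ x → ‖G x‖ ≤ M) (hx₀ : 0 < x₀) (hGx₀ : G x₀ = M) (hG₀ : G 0 ≠ M) :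
    ∃ K : ℝ, ∀ f ∈ controlledFamily G M C, ‖f 0‖ ≤ K := by
  obtain ⟨n, hn⟩ := exists_hasBoundedIncrements_dampedFamily hC hG hb hconj hM hx₀ hGx₀ hG₀
  have hdiff : ∀ f ∈ dampedFamily x₀ n (controlledFamily G M C), Differentiable ℂ f := by
    rintro _ ⟨f, hf, rfl⟩
    have := hf.1
    fun_prop
  obtain ⟨K, hK⟩ := exists_norm_apply_zero_le_of_hasBoundedIncrements hdiff hx₀ one_pos
    (by simpa using hn)
  refine ⟨K / x₀ ^ n, fun f hf => ?_⟩
  have h : ‖(0 - x₀ : ℂ) ^ n * f 0‖ ≤ K := hK _ ⟨f, hf, rfl⟩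
  rw [zero_sub, norm_mul, norm_pow, norm_neg, Complex.norm_real, Real.norm_of_nonneg hx₀.le] at h
  rwa [le_div_iff₀' (by positivity)]

end ControlledFamily

section ComplexMeasure

variable {α : Type*} [MeasurableSpace α]

instance isFiniteMeasure_variation (μ : ComplexMeasure α) : IsFiniteMeasure μ.variation := by
  refine isFiniteMeasure_of_le
    ((ComplexMeasure.re μ).totalVariation + (ComplexMeasure.im μ).totalVariation)
    (VectorMeasure.variation_le_of_forall_enorm_le fun S _ => ?_)
  have hre : ‖((μ S).re : ℂ)‖ₑ ≤ (ComplexMeasure.re μ).totalVariation S := by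
    simpa [enorm_eq_nnnorm] using! (ComplexMeasure.re μ).enorm_le_totalVariation S
  have him : ‖((μ S).im : ℂ) * Complex.I‖ₑ ≤ (ComplexMeasure.im μ).totalVariation S := by
    simpa [enorm_eq_nnnorm] using! (ComplexMeasure.im μ).enorm_le_totalVariation S
  rw [← Complex.re_add_im (μ S)]
  exact (enorm_add_le _ _).trans (add_le_add hre him)

theorem withDensityᵥ_rnDeriv_variation (μ : ComplexMeasure α) :
    μ.variation.withDensityᵥ (μ.rnDeriv μ.variation) = μ := by
  set m := μ.variation
  have hac : ∀ σ : SignedMeasure α, (∀ S, μ S = 0 → σ S = 0) →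
      m.withDensityᵥ (σ.rnDeriv m) = σ := fun σ hσ => by
    refine SignedMeasure.withDensityᵥ_rnDeriv_eq σ m (.mk fun S hS hmS => hσ S ?_)
    rw [Measure.toENNRealVectorMeasure_apply_measurable hS] at hmS
    exact enorm_eq_zero.1
      (le_zero_iff.1 ((VectorMeasure.enorm_measure_le_variation μ S).trans_eq hmS))
  have hint := μ.integrable_rnDeriv m
  ext1 S hS
  rw [withDensityᵥ_apply hint hS]
  refine Complex.ext ?_ ?_
  · rw [← RCLike.re_eq_complex_re, ← integral_re hint.integrableOn]
    exact (withDensityᵥ_apply (SignedMeasure.integrable_rnDeriv _ m) hS).symm.trans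
      (congrArg (· S) (hac (ComplexMeasure.re μ) fun S h => congrArg Complex.re h))
  · rw [← RCLike.im_eq_complex_im, ← integral_im hint.integrableOn]
    exact (withDensityᵥ_apply (SignedMeasure.integrable_rnDeriv _ m) hS).symm.trans
      (congrArg (· S) (hac (ComplexMeasure.im μ) fun S h => congrArg Complex.im h))

theorem integrable_of_norm_eq_one {m : Measure α} [IsFiniteMeasure m] {g : α → ℂ}
    (hg : Measurable g) (hg₁ : ∀ x, ‖g x‖ = 1) : Integrable g m :=
  .of_bound hg.aestronglyMeasurable 1 (.of_forall fun x => (hg₁ x).le)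

theorem variation_withDensityᵥ_of_norm_eq_one {m : Measure α} [IsFiniteMeasure m] {g : α → ℂ}
    (hg : Measurable g) (hg₁ : ∀ x, ‖g x‖ = 1) : (m.withDensityᵥ g).variation = m := by
  have hone : (fun x => ‖g x‖ₑ) = 1 := funext fun x => by simp [← ofReal_norm, hg₁]
  rw [Measure.variation_withDensityᵥ (integrable_of_norm_eq_one hg hg₁), hone, withDensity_one]

theorem exists_eq_withDensityᵥ_norm_eq_one (μ : ComplexMeasure α) :
    ∃ (m : Measure α) (_ : IsFiniteMeasure m) (g : α → ℂ),
      Measurable g ∧ (∀ x, ‖g x‖ = 1) ∧ μ = m.withDensityᵥ g := by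
  set m := μ.variation
  obtain ⟨g, hg, hgμ⟩ := (μ.integrable_rnDeriv m).aestronglyMeasurable
  have hdens : m.withDensityᵥ g = μ :=
    (WithDensityᵥEq.congr_ae hgμ).symm.trans (withDensityᵥ_rnDeriv_variation μ)
  have hone : (fun x => ‖g x‖ₑ) =ᵐ[m] 1 := by
    refine (withDensity_eq_iff_of_sigmaFinite hg.measurable.enorm.aemeasurable
      aemeasurable_const).1 ?_
    rw [← Measure.variation_withDensityᵥ ((μ.integrable_rnDeriv m).congr hgμ), hdens]
    exact withDensity_one.symm
  classical
  refine ⟨m, inferInstance, fun x => if ‖g x‖ = 1 then g x else 1, ?_, fun x => ?_, ?_⟩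
  · exact Measurable.ite (measurableSet_eq_fun hg.measurable.norm measurable_const)
      hg.measurable measurable_const
  · beta_reduce
    split_ifs with hx
    exacts [hx, norm_one]
  · refine hdens.symm.trans (WithDensityᵥEq.congr_ae ?_)
    filter_upwards [hone] with x hx
    rw [if_pos (by simp [← toReal_enorm, hx])]

theorem conjMeasure_withDensityᵥ {m : Measure α} {g : α → ℂ} (hg : Integrable g m) :
    conjMeasure (m.withDensityᵥ g) = m.withDensityᵥ fun x => conj (g x) := by
  have hg' : Integrable (fun x => conj (g x)) m :=
    (Complex.conjLIE.integrable_comp_iff).2 hg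
  ext1 S hS
  rw [withDensityᵥ_apply hg' hS, integral_conj, ← withDensityᵥ_apply hg hS]
  rfl

theorem integrable_withDensityᵥ_iff {E : Type*} [NormedAddCommGroup E] {m : Measure α}
    [IsFiniteMeasure m] {g : α → ℂ} (hg : Measurable g) (hg₁ : ∀ x, ‖g x‖ = 1) {f : α → E} :
    (m.withDensityᵥ g).Integrable f ↔ Integrable f m := by
  rw [VectorMeasure.Integrable, variation_withDensityᵥ_of_norm_eq_one hg hg₁]

variable {E F : Type*} [NormedAddCommGroup E] [NormedSpace ℂ E] [NormedAddCommGroup F]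
  [NormedSpace ℂ F]

theorem norm_complexIntegral_le_integral_norm (μ : ComplexMeasure α) (f : α → E) :
    ‖complexIntegral μ f‖ ≤ ∫ x, ‖f x‖ ∂μ.variation := by
  refine VectorMeasure.norm_integral_le_integral_norm.trans ?_
  rw [ContinuousLinearMap.opNorm_flip]
  exact mul_le_of_le_one_left (integral_nonneg fun _ => norm_nonneg _)
    (ContinuousLinearMap.opNorm_lsmul_le (𝕜 := ℝ))

theorem norm_complexIntegral_le {μ : ComplexMeasure α} {f : α → E} {C : ℝ}
    (hf : ∀ᵐ x ∂μ.variation, ‖f x‖ ≤ C) :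
    ‖complexIntegral μ f‖ ≤ C * μ.variation.real univ := by
  refine (norm_complexIntegral_le_integral_norm μ f).trans ((Real.le_norm_self _).trans ?_)
  exact norm_integral_le_of_norm_le_const (by simpa only [norm_norm] using hf)

theorem integrable_smul_of_norm_eq_one {m : Measure α} {g : α → ℂ} (hg : Measurable g)
    (hg₁ : ∀ x, ‖g x‖ = 1) {f : α → E} (hf : Integrable f m) :
    Integrable (fun x => g x • f x) m :=
  hf.bdd_smul 1 hg.aestronglyMeasurable (.of_forall fun x => (hg₁ x).le)

theorem continuous_integral_smul {m : Measure α} {g : α → ℂ} (hg : Measurable g)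
    (hg₁ : ∀ x, ‖g x‖ = 1) : Continuous fun f : α →₁[m] E => ∫ x, g x • f x ∂m := by
  have hgf : ∀ f : α →₁[m] E, Integrable (fun x => g x • f x) m := fun f =>
    integrable_smul_of_norm_eq_one hg hg₁ (L1.integrable_coeFn f)
  refine continuous_iff_continuousAt.2 fun f₀ =>
    tendsto_integral_of_L1 _ (hgf f₀).aestronglyMeasurable (.of_forall hgf) ?_
  have hdist : ∀ f : α →₁[m] E, ∫⁻ x, ‖g x • f x - g x • f₀ x‖ₑ ∂m = edist f f₀ := fun f => by
    rw [L1.edist_def]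
    refine lintegral_congr fun x => ?_
    rw [edist_eq_enorm_sub, ← smul_sub, enorm_smul, ← ofReal_norm (g x), hg₁, ENNReal.ofReal_one,
      one_mul]
  simp only [hdist]
  have hcont : Continuous fun f : α →₁[m] E => edist f f₀ := by fun_prop
  simpa only [edist_self] using hcont.tendsto f₀

theorem complexIntegral_withDensityᵥ [CompleteSpace E] {m : Measure α} [IsFiniteMeasure m]
    {g : α → ℂ} (hg : Measurable g) (hg₁ : ∀ x, ‖g x‖ = 1) {f : α → E} (hf : Integrable f m) :
    complexIntegral (m.withDensityᵥ g) f = ∫ x, g x • f x ∂m := by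
  have hvar := variation_withDensityᵥ_of_norm_eq_one (m := m) hg hg₁
  refine hf.induction (fun f => complexIntegral (m.withDensityᵥ g) f = ∫ x, g x • f x ∂m)
    (fun c S hS hmS => ?_) (fun f₁ f₂ _ hf₁ hf₂ ih₁ ih₂ => ?_) ?_ fun f₁ f₂ h _ ih => ?_
  · have hind : (fun x => g x • S.indicator (fun _ => c) x) = S.indicator fun x => g x • c := by
      ext x
      by_cases hx : x ∈ S <;> simp [hx]
    rw [complexIntegral, VectorMeasure.integral_eq_setToFun,
      setToFun_indicator_const _ hS (by rwa [hvar, ← lt_top_iff_ne_top]), hind,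
      integral_indicator hS, integral_smul_const,
      ← withDensityᵥ_apply (integrable_of_norm_eq_one hg hg₁) hS]
    rfl
  · simp only [Pi.add_apply, smul_add]
    rw [integral_add (integrable_smul_of_norm_eq_one hg hg₁ hf₁)
      (integrable_smul_of_norm_eq_one hg hg₁ hf₂), ← ih₁, ← ih₂]
    exact VectorMeasure.integral_add (by rwa [integrable_withDensityᵥ_iff hg hg₁])
      (by rwa [integrable_withDensityᵥ_iff hg hg₁])
  · have hcont : Continuous fun f : α →₁[m] E => complexIntegral (m.withDensityᵥ g) f := by
      generalize m.withDensityᵥ g = μ at hvar ⊢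
      subst hvar
      exact VectorMeasure.continuous_integral
    exact isClosed_eq hcont (continuous_integral_smul hg hg₁)
  · have hcongr : complexIntegral (m.withDensityᵥ g) f₁ = complexIntegral (m.withDensityᵥ g) f₂ :=
      VectorMeasure.integral_congr_ae (by rwa [hvar])
    rw [← hcongr, ih]
    exact integral_congr_ae (h.mono fun x hx => congrArg (g x • ·) hx)

theorem variation_conjMeasure (μ : ComplexMeasure α) :
    (conjMeasure μ).variation = μ.variation := by
  obtain ⟨m, _, g, hg, hg₁, hμ⟩ := exists_eq_withDensityᵥ_norm_eq_one μ
  rw [hμ, conjMeasure_withDensityᵥ (integrable_of_norm_eq_one hg hg₁),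
    variation_withDensityᵥ_of_norm_eq_one hg hg₁]
  exact variation_withDensityᵥ_of_norm_eq_one (Complex.continuous_conj.measurable.comp hg)
    fun x => (RCLike.norm_conj _).trans (hg₁ x)

theorem complexIntegral_conjMeasure {μ : ComplexMeasure α} {f : α → ℂ} (hf : μ.Integrable f) :
    complexIntegral (conjMeasure μ) f = conj (complexIntegral μ fun x => conj (f x)) := by
  obtain ⟨m, _, g, hg, hg₁, rfl⟩ := exists_eq_withDensityᵥ_norm_eq_one μ
  rw [integrable_withDensityᵥ_iff hg hg₁] at hf
  have hconj : Integrable (fun x => conj (f x)) m := (Complex.conjLIE.integrable_comp_iff).2 hf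
  rw [conjMeasure_withDensityᵥ (integrable_of_norm_eq_one hg hg₁),
    complexIntegral_withDensityᵥ hg hg₁ hconj, ← integral_conj]
  simp only [smul_eq_mul, map_mul, Complex.conj_conj]
  exact complexIntegral_withDensityᵥ (Complex.continuous_conj.measurable.comp hg)
    (fun x => (RCLike.norm_conj _).trans (hg₁ x)) hf

theorem apply_complexIntegral [CompleteSpace E] [CompleteSpace F] (L : E →L[ℂ] F)
    {μ : ComplexMeasure α} {f : α → E} (hf : μ.Integrable f) :
    L (complexIntegral μ f) = complexIntegral μ fun x => L (f x) := by
  obtain ⟨m, _, g, hg, hg₁, rfl⟩ := exists_eq_withDensityᵥ_norm_eq_one μ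
  rw [integrable_withDensityᵥ_iff hg hg₁] at hf
  rw [complexIntegral_withDensityᵥ hg hg₁ hf,
    complexIntegral_withDensityᵥ hg hg₁ (L.integrable_comp hf)]
  simp only [← map_smul]
  exact (L.integral_comp_comm (integrable_smul_of_norm_eq_one hg hg₁ hf)).symm

end ComplexMeasure

section Laplace

variable {μ : ComplexMeasure (Ioi (0 : ℝ))}

theorem norm_exp_neg_mul_le_one {z : ℂ} (hz : 0 ≤ z.re) {t : ℝ} (ht : 0 ≤ t) :
    ‖Complex.exp (-z * t)‖ ≤ 1 := by
  rw [Complex.norm_exp, Complex.re_mul_ofReal, Complex.neg_re, Real.exp_le_one_iff]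
  nlinarith

theorem norm_mul_exp_neg_mul_le {c t : ℝ} (hc : 0 < c) (ht : 0 ≤ t) {z : ℂ} (hz : c ≤ z.re) :
    ‖(t : ℂ) * Complex.exp (-z * t)‖ ≤ 1 / c := by
  rw [norm_mul, Complex.norm_of_nonneg ht, Complex.norm_exp, Complex.re_mul_ofReal, Complex.neg_re,
    le_div_iff₀ hc]
  calc t * Real.exp (-z.re * t) * c = c * t * Real.exp (-z.re * t) := by ring
    _ ≤ Real.exp (c * t) * Real.exp (-z.re * t) := by
        gcongr
        linarith [Real.add_one_le_exp (c * t)]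
    _ ≤ 1 := by
        rw [← Real.exp_add, Real.exp_le_one_iff]
        nlinarith

theorem integrable_exp_neg_mul (m : Measure (Ioi (0 : ℝ))) [IsFiniteMeasure m] {z : ℂ}
    (hz : 0 ≤ z.re) : Integrable (fun ξ : Ioi (0 : ℝ) => Complex.exp (-z * (ξ : ℝ))) m :=
  .of_bound (Measurable.aestronglyMeasurable (by fun_prop)) 1
    (.of_forall fun ξ => norm_exp_neg_mul_le_one hz (le_of_lt ξ.2))

theorem norm_laplace_le {z : ℂ} (hz : 0 ≤ z.re) : ‖laplace μ z‖ ≤ μ.variation.real univ := by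
  simpa only [laplace, one_mul] using norm_complexIntegral_le (μ := μ)
    (.of_forall fun ξ : Ioi (0 : ℝ) => norm_exp_neg_mul_le_one hz (le_of_lt ξ.2))

theorem laplace_conjMeasure {z : ℂ} (hz : 0 ≤ z.re) :
    laplace (conjMeasure μ) z = conj (laplace μ (conj z)) := by
  rw [laplace, laplace, complexIntegral_conjMeasure (integrable_exp_neg_mul _ hz)]
  simp only [← Complex.exp_conj, map_mul, map_neg, Complex.conj_ofReal]

variable {m : Measure (Ioi (0 : ℝ))} [IsFiniteMeasure m] {g : Ioi (0 : ℝ) → ℂ}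

theorem laplace_withDensityᵥ (hg : Measurable g) (hg₁ : ∀ ξ, ‖g ξ‖ = 1) {z : ℂ} (hz : 0 ≤ z.re) :
    laplace (m.withDensityᵥ g) z = ∫ ξ, g ξ * Complex.exp (-z * (ξ : ℝ)) ∂m :=
  complexIntegral_withDensityᵥ hg hg₁ (integrable_exp_neg_mul m hz)

theorem differentiableAt_integral_mul_exp_neg_mul (hg : Measurable g) (hg₁ : ∀ ξ, ‖g ξ‖ = 1)
    {z₀ : ℂ} (hz₀ : 0 < z₀.re) :
    DifferentiableAt ℂ (fun z => ∫ ξ, g ξ * Complex.exp (-z * (ξ : ℝ)) ∂m) z₀ := by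
  have hball : ∀ z ∈ Metric.ball z₀ (z₀.re / 2), z₀.re / 2 ≤ z.re := fun z hz => by
    have hre := (Complex.abs_re_le_norm (z - z₀)).trans (mem_ball_iff_norm.1 hz).le
    rw [Complex.sub_re] at hre
    linarith [neg_abs_le (z.re - z₀.re)]
  refine (hasDerivAt_integral_of_dominated_loc_of_deriv_le (𝕜 := ℂ) (μ := m)
    (F := fun z (ξ : Ioi (0 : ℝ)) => g ξ * Complex.exp (-z * (ξ : ℝ)))
    (F' := fun z (ξ : Ioi (0 : ℝ)) => g ξ * -((ξ : ℝ) * Complex.exp (-z * (ξ : ℝ))))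
    (bound := fun _ => 1 / (z₀.re / 2)) (Metric.ball_mem_nhds z₀ (half_pos hz₀))
    (.of_forall fun z => (hg.mul (by fun_prop)).aestronglyMeasurable)
    (integrable_smul_of_norm_eq_one hg hg₁ (integrable_exp_neg_mul m hz₀.le))
    (hg.mul (by fun_prop)).aestronglyMeasurable (.of_forall fun ξ z hz => ?_)
    (integrable_const _) (.of_forall fun ξ z _ => ?_)).2.differentiableAt
  · rw [norm_mul, hg₁, one_mul, norm_neg]
    exact norm_mul_exp_neg_mul_le (half_pos hz₀) (le_of_lt ξ.2) (hball z hz)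
  · have hexp := ((hasDerivAt_id z).neg.mul_const ((ξ : ℝ) : ℂ)).cexp.const_mul (g ξ)
    simpa [mul_comm, mul_left_comm] using! hexp

theorem continuousOn_laplace : ContinuousOn (laplace μ) {z | 0 ≤ z.re} := by
  obtain ⟨m, _, g, hg, hg₁, rfl⟩ := exists_eq_withDensityᵥ_norm_eq_one μ
  refine ContinuousOn.congr ?_ fun z hz => laplace_withDensityᵥ hg hg₁ hz
  refine continuousOn_of_dominated (bound := fun _ => 1)
    (fun z _ => (hg.mul (by fun_prop)).aestronglyMeasurable) (fun z hz => .of_forall fun ξ => ?_)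
    (integrable_const _) (.of_forall fun ξ => by fun_prop)
  rw [norm_mul, hg₁, one_mul]
  exact norm_exp_neg_mul_le_one hz (le_of_lt ξ.2)

theorem differentiableOn_laplace : DifferentiableOn ℂ (laplace μ) {z | 0 < z.re} := by
  obtain ⟨m, _, g, hg, hg₁, rfl⟩ := exists_eq_withDensityᵥ_norm_eq_one μ
  exact DifferentiableOn.congr
    (fun z hz => (differentiableAt_integral_mul_exp_neg_mul hg hg₁ hz).differentiableWithinAt)
    fun z hz => laplace_withDensityᵥ hg hg₁ (le_of_lt hz)

theorem diffContOnCl_laplace : DiffContOnCl ℂ (laplace μ) {z | 0 < z.re} where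
  differentiableOn := differentiableOn_laplace
  continuousOn := by
    rw [Complex.closure_setOfPred_lt_re]
    exact continuousOn_laplace

theorem tendsto_laplace_ofReal_atTop (μ : ComplexMeasure (Ioi (0 : ℝ))) :
    Tendsto (fun x : ℝ => laplace μ x) atTop (𝓝 0) := by
  obtain ⟨m, _, g, hg, hg₁, rfl⟩ := exists_eq_withDensityᵥ_norm_eq_one μ
  have hlim : Tendsto (fun x : ℝ => ∫ ξ, g ξ * Complex.exp (-x * (ξ : ℝ)) ∂m) atTop
      (𝓝 (∫ _, 0 ∂m)) := by
    refine tendsto_integral_filter_of_dominated_convergence (fun _ => 1)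
      (.of_forall fun x => (hg.mul (by fun_prop)).aestronglyMeasurable) ?_ (integrable_const _)
      (.of_forall fun ξ => ?_)
    · filter_upwards [eventually_ge_atTop 0] with x hx
      refine .of_forall fun ξ => ?_
      rw [norm_mul, hg₁, one_mul]
      exact norm_exp_neg_mul_le_one hx (le_of_lt ξ.2)
    · have hexp : Tendsto (fun x : ℝ => Real.exp (-(x * ξ))) atTop (𝓝 0) :=
        Real.tendsto_exp_neg_atTop_nhds_zero.comp (tendsto_id.atTop_mul_const ξ.2)
      simpa using ((Complex.continuous_ofReal.tendsto 0).comp hexp).const_mul (g ξ)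
  rw [integral_zero] at hlim
  refine hlim.congr' ?_
  filter_upwards [eventually_ge_atTop 0] with x hx
  exact (laplace_withDensityᵥ hg hg₁ hx).symm

theorem laplace_zero : laplace μ 0 = μ univ := by
  obtain ⟨m, _, g, hg, hg₁, rfl⟩ := exists_eq_withDensityᵥ_norm_eq_one μ
  rw [laplace_withDensityᵥ hg hg₁ le_rfl,
    withDensityᵥ_apply (integrable_of_norm_eq_one hg hg₁) .univ, setIntegral_univ]
  simp only [neg_zero, zero_mul, Complex.exp_zero, mul_one]

/-- The function `ξ ↦ exp (-ξ)`, whose powers separate finite measures on the half-line. -/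
noncomputable def expNeg : BoundedContinuousFunction (Ioi (0 : ℝ)) ℝ :=
  .ofNormedAddCommGroup (fun ξ => Real.exp (-ξ)) (by fun_prop) 1 fun ξ => by
    rw [Real.norm_of_nonneg (Real.exp_pos _).le, Real.exp_le_one_iff, neg_nonpos]
    exact le_of_lt ξ.2

theorem expNeg_pow_apply (n : ℕ) (ξ : Ioi (0 : ℝ)) : (expNeg ^ n) ξ = Real.exp (-(n * ξ)) := by
  rw [BoundedContinuousFunction.pow_apply, neg_mul_eq_mul_neg, Real.exp_nat_mul]
  rfl

open Polynomial in
/-- The star subalgebra of the polynomials in `expNeg`. -/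
noncomputable def expNegAlgebra : StarSubalgebra ℝ (BoundedContinuousFunction (Ioi (0 : ℝ)) ℝ) where
  __ := (aeval (R := ℝ) expNeg).range
  star_mem' {f} hf := by rwa [show star f = f by ext; simp]

theorem measure_eq_of_integral_exp_neg_nat {P Q : Measure (Ioi (0 : ℝ))} [IsFiniteMeasure P]
    [IsFiniteMeasure Q]
    (h : ∀ n : ℕ, ∫ ξ, Real.exp (-(n * ξ)) ∂P = ∫ ξ, Real.exp (-(n * ξ)) ∂Q) : P = Q := by
  have : PolishSpace (Ioi (0 : ℝ)) := isOpen_Ioi.polishSpace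
  refine ext_of_forall_mem_subalgebra_integral_eq_of_polish (A := expNegAlgebra) ?_ ?_
  · intro ξ ζ hne
    refine ⟨expNeg, ⟨_, ⟨expNeg, ⟨Polynomial.X, Polynomial.aeval_X _⟩, rfl⟩, rfl⟩,
      fun heq => hne ?_⟩
    exact Subtype.ext (neg_injective (Real.exp_injective heq))
  · rintro _ ⟨p, rfl⟩
    change ∫ ξ, Polynomial.aeval expNeg p ξ ∂P = ∫ ξ, Polynomial.aeval expNeg p ξ ∂Q
    induction p using Polynomial.induction_on' with
    | add p q hp hq =>
      simp only [map_add, BoundedContinuousFunction.add_apply]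
      rw [integral_add (BoundedContinuousFunction.integrable _ _)
        (BoundedContinuousFunction.integrable _ _), hp, hq, ← integral_add
        (BoundedContinuousFunction.integrable _ _) (BoundedContinuousFunction.integrable _ _)]
    | monomial n c =>
      simp only [Polynomial.aeval_monomial, ← Algebra.smul_def, expNeg_pow_apply,
        BoundedContinuousFunction.smul_apply, integral_smul, h]

theorem withDensityᵥ_eq_zero_of_integral_exp_neg_nat {m : Measure (Ioi (0 : ℝ))}
    {u : Ioi (0 : ℝ) → ℝ} (hu : Integrable u m)
    (h : ∀ n : ℕ, ∫ ξ, u ξ * Real.exp (-(n * ξ)) ∂m = 0) : m.withDensityᵥ u = 0 := by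
  have := isFiniteMeasure_withDensity_ofReal hu.2
  have := isFiniteMeasure_withDensity_ofReal hu.neg.2
  rw [withDensityᵥ_eq_withDensity_pos_part_sub_withDensity_neg_part hu, sub_eq_zero]
  have hdens : ∀ v : Ioi (0 : ℝ) → ℝ, Integrable v m → ∀ n : ℕ,
      ∫ ξ, Real.exp (-(n * ξ)) ∂m.withDensity (fun ξ => ENNReal.ofReal (v ξ)) =
        ∫ ξ, max (v ξ) 0 * Real.exp (-(n * ξ)) ∂m := fun v hv n => by
    rw [integral_withDensity_eq_integral_toReal_smul₀ hv.1.aemeasurable.ennreal_ofReal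
      (.of_forall fun _ => ENNReal.ofReal_lt_top)]
    simp only [ENNReal.toReal_ofReal', smul_eq_mul]
  have hint : ∀ v : Ioi (0 : ℝ) → ℝ, Integrable v m → ∀ n : ℕ,
      Integrable (fun ξ => max (v ξ) 0 * Real.exp (-(n * ξ))) m := fun v hv n => by
    simp only [← expNeg_pow_apply]
    exact hv.pos_part.mul_bdd (expNeg ^ n).continuous.aestronglyMeasurable
      (.of_forall (expNeg ^ n).norm_coe_le_norm)
  congr 1
  refine measure_eq_of_integral_exp_neg_nat fun n => ?_
  rw [hdens u hu, hdens (fun ξ => -u ξ) hu.neg, ← sub_eq_zero,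
    ← integral_sub (hint u hu n) (hint (fun ξ => -u ξ) hu.neg n)]
  simpa only [← sub_mul, max_zero_sub_max_neg_zero_eq_self] using h n

theorem eq_zero_of_laplace_natCast_eq_zero (h : ∀ n : ℕ, laplace μ n = 0) : μ = 0 := by
  obtain ⟨m, _, g, hg, hg₁, rfl⟩ := exists_eq_withDensityᵥ_norm_eq_one μ
  have hgint : Integrable g m := integrable_of_norm_eq_one hg hg₁
  have hzero : ∀ n : ℕ, ∫ ξ, g ξ * (Real.exp (-(n * ξ)) : ℂ) ∂m = 0 := fun n => by
    rw [← h n, laplace_withDensityᵥ hg hg₁ n.cast_nonneg]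
    simp
  have hint : ∀ n : ℕ, Integrable (fun ξ => g ξ * (Real.exp (-(n * ξ)) : ℂ)) m := fun n => by
    simpa using! integrable_smul_of_norm_eq_one hg hg₁ (integrable_exp_neg_mul m n.cast_nonneg)
  have hre : m.withDensityᵥ (fun ξ => RCLike.re (g ξ)) = 0 := by
    refine withDensityᵥ_eq_zero_of_integral_exp_neg_nat hgint.re fun n => ?_
    simpa only [RCLike.re_eq_complex_re, Complex.re_mul_ofReal, hzero, map_zero]
      using integral_re (hint n)
  have him : m.withDensityᵥ (fun ξ => RCLike.im (g ξ)) = 0 := by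
    refine withDensityᵥ_eq_zero_of_integral_exp_neg_nat hgint.im fun n => ?_
    simpa only [RCLike.im_eq_complex_im, Complex.im_mul_ofReal, hzero, map_zero]
      using integral_im (hint n)
  ext1 S hS
  rw [withDensityᵥ_apply hgint hS, ← integral_re_add_im hgint.integrableOn,
    ← withDensityᵥ_apply hgint.re hS, ← withDensityᵥ_apply hgint.im hS, hre, him]
  simp

theorem exists_isMaxOn_norm_laplace (hμ : μ ≠ 0) (hμ₀ : μ univ = 0) :
    ∃ x₀ : ℝ, 0 < x₀ ∧ laplace μ x₀ ≠ 0 ∧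
      ∀ x : ℝ, 0 ≤ x → ‖laplace μ x‖ ≤ ‖laplace μ x₀‖ := by
  obtain ⟨n, hn⟩ : ∃ n : ℕ, laplace μ n ≠ 0 := by
    by_contra! hzero
    exact hμ (eq_zero_of_laplace_natCast_eq_zero hzero)
  rw [← norm_pos_iff] at hn
  have hlim : Tendsto (fun x : ℝ => ‖laplace μ x‖) atTop (𝓝 0) := by
    simpa only [norm_zero] using (tendsto_laplace_ofReal_atTop μ).norm
  obtain ⟨R, hR⟩ := eventually_atTop.1 (hlim.eventually_lt_const hn)
  have hcont : ContinuousOn (fun x : ℝ => ‖laplace μ x‖) (Icc 0 (max R n)) :=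
    (continuousOn_laplace.comp Complex.continuous_ofReal.continuousOn fun x hx => hx.1).norm
  obtain ⟨x₀, hx₀, hmax⟩ :=
    isCompact_Icc.exists_isMaxOn ⟨(n : ℝ), n.cast_nonneg, le_max_right R n⟩ hcont
  have hn₀ : ‖laplace μ n‖ ≤ ‖laplace μ x₀‖ := hmax ⟨n.cast_nonneg, le_max_right R n⟩
  have hx₀_ne : laplace μ x₀ ≠ 0 := norm_pos_iff.1 (hn.trans_le hn₀)
  refine ⟨x₀, hx₀.1.lt_of_ne ?_, hx₀_ne, fun x hx => ?_⟩
  · rintro rfl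
    exact hx₀_ne (laplace_zero.trans hμ₀)
  · rcases le_total x (max R n) with hle | hle
    · exact hmax ⟨hx, hle⟩
    · exact (hR x ((le_max_left _ _).trans hle)).le.trans hn₀

end Laplace

section ExpTransform

variable {E : Type*} [NormedAddCommGroup E] {u : ℝ → E}

/-- Continuity on `(0, ∞)` together with decay faster than every exponential. The decay estimates
hold on all of `(0, ∞)`, so that `u` is also bounded near `0`. -/
structure HasSuperexponentialDecay (u : ℝ → E) : Prop where
  continuousOn : ContinuousOn u (Ioi 0)
  exists_norm_le : ∀ b : ℝ, ∃ C : ℝ, ∀ t : ℝ, 0 < t → ‖u t‖ ≤ C * Real.exp (-(b * t))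

namespace HasSuperexponentialDecay

theorem comp_mul_left (hu : HasSuperexponentialDecay u) {s : ℝ} (hs : 0 < s) :
    HasSuperexponentialDecay fun t => u (s * t) where
  continuousOn := hu.continuousOn.comp (by fun_prop) fun _ ht => mul_pos hs ht
  exists_norm_le b := by
    obtain ⟨C, hC⟩ := hu.exists_norm_le (b / s)
    refine ⟨C, fun t ht => (hC _ (mul_pos hs ht)).trans_eq ?_⟩
    rw [← mul_assoc, div_mul_cancel₀ b hs.ne']

theorem exists_norm_le_const (hu : HasSuperexponentialDecay u) :
    ∃ C : ℝ, ∀ t : ℝ, 0 < t → ‖u t‖ ≤ C := by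
  simpa using hu.exists_norm_le 0

end HasSuperexponentialDecay

variable {F : Type*} [NormedAddCommGroup F] [NormedSpace ℂ E] [NormedSpace ℂ F] {K : ℝ} {z : ℂ}

/-- The Laplace transform `z ↦ ∫₀^∞ exp (z t) u(t) dt` of a function on `(0, ∞)`, with the
sign in the exponent for which it is trivially bounded on left half-planes. -/
noncomputable def expTransform (u : ℝ → E) (z : ℂ) : E :=
  ∫ t in Ioi (0 : ℝ), Complex.exp (z * t) • u t

theorem norm_exp_mul_ofReal_smul (z : ℂ) (t : ℝ) (x : E) :
    ‖Complex.exp (z * t) • x‖ = Real.exp (z.re * t) * ‖x‖ := by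
  rw [norm_smul, Complex.norm_exp, Complex.re_mul_ofReal]

theorem integral_Ioi_comp_add_right (u : ℝ → E) (b : ℝ) :
    ∫ t in Ioi (0 : ℝ), u (t + b) = ∫ t in Ioi b, u t := by
  rw [← (measurePreserving_add_right volume b).setIntegral_preimage_emb
    (measurableEmbedding_addRight b) u (Ioi b)]
  simp only [preimage_add_const_Ioi, sub_self]

namespace HasSuperexponentialDecay

theorem clm_apply (hu : HasSuperexponentialDecay u) (L : E →L[ℂ] F) :
    HasSuperexponentialDecay fun t => L (u t) where
  continuousOn := L.continuous.comp_continuousOn hu.continuousOn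
  exists_norm_le b := by
    obtain ⟨C, hC⟩ := hu.exists_norm_le b
    refine ⟨‖L‖ * C, fun t ht => ?_⟩
    rw [mul_assoc]
    exact L.le_opNorm_of_le (hC t ht)

theorem aestronglyMeasurable_smul (hu : HasSuperexponentialDecay u) {k : ℝ → ℂ}
    (hk : Continuous k) :
    AEStronglyMeasurable (fun t => k t • u t) (volume.restrict (Ioi 0)) :=
  (hk.continuousOn.smul hu.continuousOn).aestronglyMeasurable measurableSet_Ioi

theorem integrableOn_exp_smul (hu : HasSuperexponentialDecay u) (z : ℂ) :
    IntegrableOn (fun t : ℝ => Complex.exp (z * t) • u t) (Ioi 0) := by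
  obtain ⟨C, hC⟩ := hu.exists_norm_le (z.re + 1)
  refine ((integrableOn_exp_mul_Ioi (a := -1) (by norm_num) 0).const_mul C).mono'
    (hu.aestronglyMeasurable_smul (by fun_prop)) (ae_restrict_of_forall_mem measurableSet_Ioi
      fun t ht => ?_)
  calc ‖Complex.exp (z * t) • u t‖ ≤ Real.exp (z.re * t) * (C * Real.exp (-((z.re + 1) * t))) := by
        rw [norm_exp_mul_ofReal_smul]
        gcongr
        exact hC t ht
    _ = C * Real.exp (-1 * t) := by
        rw [mul_left_comm, ← Real.exp_add]
        ring_nf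

theorem integrableOn (hu : HasSuperexponentialDecay u) : IntegrableOn u (Ioi 0) := by
  simpa using hu.integrableOn_exp_smul 0

theorem differentiable_expTransform (hu : HasSuperexponentialDecay u) :
    Differentiable ℂ (expTransform u) := by
  intro z₀
  have hbound : Integrable (fun t : ℝ => Real.exp ((z₀.re + 2) * t) * ‖u t‖)
      (volume.restrict (Ioi 0)) := by
    refine (hu.integrableOn_exp_smul ((z₀.re + 2 : ℝ) : ℂ)).norm.congr (.of_forall fun t => ?_)
    simp only [norm_exp_mul_ofReal_smul, Complex.ofReal_re]
  refine (hasDerivAt_integral_of_dominated_loc_of_deriv_le (𝕜 := ℂ)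
    (μ := volume.restrict (Ioi (0 : ℝ))) (F := fun z t => Complex.exp (z * t) • u t)
    (F' := fun z t => (t * Complex.exp (z * t)) • u t) (Metric.ball_mem_nhds z₀ one_pos)
    (.of_forall fun z => hu.aestronglyMeasurable_smul (by fun_prop))
    (hu.integrableOn_exp_smul z₀) (hu.aestronglyMeasurable_smul (by fun_prop))
    (ae_restrict_of_forall_mem measurableSet_Ioi fun t ht z hz => ?_) hbound
    (.of_forall fun t z _ => ?_)).2.differentiableAt
  · have hre : z.re ≤ z₀.re + 1 := by
      have hsub := (Complex.abs_re_le_norm (z - z₀)).trans (mem_ball_iff_norm.1 hz).le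
      rw [Complex.sub_re] at hsub
      linarith [le_abs_self (z.re - z₀.re)]
    have ht₀ : 0 < t := ht
    rw [mul_smul, norm_smul, norm_exp_mul_ofReal_smul, Complex.norm_of_nonneg ht₀.le, ← mul_assoc]
    gcongr
    calc t * Real.exp (z.re * t) ≤ Real.exp t * Real.exp ((z₀.re + 1) * t) := by
          gcongr
          linarith [Real.add_one_le_exp t]
      _ = Real.exp ((z₀.re + 2) * t) := by rw [← Real.exp_add]; ring_nf
  · have hexp := ((hasDerivAt_id z).mul_const (t : ℂ)).cexp.smul_const (u t)
    simpa [mul_comm] using! hexp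

theorem exp_smul_expTransform_sub (hu : HasSuperexponentialDecay u) (z : ℂ) {ξ : ℝ} (hξ : 0 ≤ ξ) :
    Complex.exp (-z * ξ) • expTransform u z - expTransform (fun t => u (t + ξ)) z =
      ∫ t in (0 : ℝ)..ξ, Complex.exp (z * (t - ξ : ℝ)) • u t := by
  have hshift : ∀ t : ℝ, Complex.exp (z * (t - ξ : ℝ)) • u t =
      Complex.exp (-z * ξ) • Complex.exp (z * t) • u t := fun t => by
    rw [smul_smul, ← Complex.exp_add]
    push_cast
    ring_nf
  have htrans : expTransform (fun t => u (t + ξ)) z =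
      Complex.exp (-z * ξ) • ∫ t in Ioi ξ, Complex.exp (z * t) • u t := by
    rw [expTransform, ← integral_smul, ← integral_Ioi_comp_add_right _ ξ]
    simp only [← hshift, add_sub_cancel_right]
  simp only [hshift, htrans, intervalIntegral.integral_smul]
  rw [← smul_sub, expTransform,
    intervalIntegral.integral_Ioi_sub_Ioi (hu.integrableOn_exp_smul z) hξ]

theorem norm_exp_smul_expTransform_sub_le (hu : HasSuperexponentialDecay u)
    (hK : ∀ t : ℝ, 0 < t → ‖u t‖ ≤ K) (hz : 0 < z.re) {ξ : ℝ} (hξ : 0 ≤ ξ) :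
    ‖Complex.exp (-z * ξ) • expTransform u z - expTransform (fun t => u (t + ξ)) z‖ ≤
      K / z.re := by
  have hK₀ : 0 ≤ K := (norm_nonneg _).trans (hK 1 one_pos)
  rw [hu.exp_smul_expTransform_sub z hξ]
  calc ‖∫ t in (0 : ℝ)..ξ, Complex.exp (z * (t - ξ : ℝ)) • u t‖
      ≤ ∫ t in (0 : ℝ)..ξ, Real.exp (z.re * (t - ξ)) * K := by
        refine intervalIntegral.norm_integral_le_of_norm_le hξ (.of_forall fun t ht => ?_)
          (Continuous.intervalIntegrable (by fun_prop) _ _)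
        rw [norm_exp_mul_ofReal_smul]
        gcongr
        exact hK t ht.1
    _ = (1 - Real.exp (-(z.re * ξ))) * (K / z.re) := by
        simp only [mul_sub]
        rw [intervalIntegral.integral_mul_const,
          intervalIntegral.integral_comp_mul_sub _ hz.ne', integral_exp]
        simp only [sub_self, mul_zero, zero_sub, Real.exp_zero, smul_eq_mul]
        ring
    _ ≤ 1 * (K / z.re) := by
        gcongr
        linarith [Real.exp_pos (-(z.re * ξ))]
    _ = K / z.re := one_mul _

end HasSuperexponentialDecay

theorem norm_expTransform_le (hK : ∀ t : ℝ, 0 < t → ‖u t‖ ≤ K) (hz : z.re < 0) :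
    ‖expTransform u z‖ ≤ K / -z.re := by
  calc ‖expTransform u z‖ ≤ ∫ t in Ioi (0 : ℝ), Real.exp (z.re * t) * K := by
        refine norm_integral_le_of_norm_le ((integrableOn_exp_mul_Ioi hz 0).mul_const K)
          (ae_restrict_of_forall_mem measurableSet_Ioi fun t ht => ?_)
        rw [norm_exp_mul_ofReal_smul]
        gcongr
        exact hK t ht
    _ = K / -z.re := by
        rw [integral_mul_const, integral_exp_mul_Ioi hz, mul_zero, Real.exp_zero, div_neg, neg_div]
        ring

theorem expTransform_comp_mul_left_zero (u : ℝ → E) {s : ℝ} (hs : 0 < s) :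
    expTransform (fun t => u (s * t)) 0 = s⁻¹ • ∫ t in Ioi (0 : ℝ), u t := by
  simp only [expTransform, zero_mul, Complex.exp_zero, one_smul]
  rw [integral_comp_mul_left_Ioi u 0 hs, mul_zero]

theorem HasSuperexponentialDecay.apply_expTransform [CompleteSpace E] [CompleteSpace F]
    (hu : HasSuperexponentialDecay u) (L : E →L[ℂ] F) (z : ℂ) :
    L (expTransform u z) = expTransform (fun t => L (u t)) z := by
  simp only [expTransform, ← map_smul]
  exact (L.integral_comp_comm (hu.integrableOn_exp_smul z)).symm

theorem HasSuperexponentialDecay.eq_zero_of_integral_Ioi_eq_zero [CompleteSpace E]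
    (hu : HasSuperexponentialDecay u) (h : ∀ b : ℝ, 0 < b → ∫ t in Ioi b, u t = 0) {a : ℝ}
    (ha : 0 < a) : u a = 0 := by
  have hderiv : HasDerivAt (fun b => ∫ t in (0 : ℝ)..b, u t) (u a) a :=
    intervalIntegral.integral_hasDerivAt_right
      ((intervalIntegrable_iff_integrableOn_Ioc_of_le ha.le).2
        (hu.integrableOn.mono_set Ioc_subset_Ioi_self))
      (hu.continuousOn.stronglyMeasurableAtFilter isOpen_Ioi a ha)
      (hu.continuousOn.continuousAt (Ioi_mem_nhds ha))
  have hconst : (fun b => ∫ t in (0 : ℝ)..b, u t) =ᶠ[𝓝 a] fun _ => ∫ t in Ioi (0 : ℝ), u t := by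
    filter_upwards [Ioi_mem_nhds ha] with b hb
    rw [← intervalIntegral.integral_Ioi_sub_Ioi hu.integrableOn (le_of_lt hb), h b hb, sub_zero]
  exact hderiv.unique ((hasDerivAt_const a _).congr_of_eventuallyEq hconst)

end ExpTransform

section Semigroup

theorem exists_integral_norm_le {α E F : Type*} [MeasurableSpace α] {m : Measure α}
    [NormedAddCommGroup E] [NormedSpace ℂ E] [CompleteSpace E] [NormedAddCommGroup F]
    [NormedSpace ℂ F] [CompleteSpace F] {Φ : α → E →L[ℂ] F}
    (hΦ : ∀ x, Integrable (fun a => Φ a x) m) :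
    ∃ C : ℝ, ∀ x, ∫ a, ‖Φ a x‖ ∂m ≤ C * ‖x‖ := by
  let J : E →ₗ[ℂ] α →₁[m] F :=
    { toFun := fun x => (hΦ x).toL1
      map_add' := fun x y => by
        simp only [map_add]
        exact Integrable.toL1_add _ _ (hΦ x) (hΦ y)
      map_smul' := fun c x => by
        simp only [map_smul]
        exact Integrable.toL1_smul _ (hΦ x) c }
  have hJ : Continuous J := by
    refine J.continuous_of_seq_closed_graph fun u x f hu hf => ?_
    obtain ⟨k, hk, hae⟩ := (tendstoInMeasure_of_tendsto_Lp hf).exists_seq_tendsto_ae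
    have hcoe : ∀ᵐ a ∂m, ∀ n, J (u (k n)) a = Φ a (u (k n)) :=
      ae_all_iff.2 fun n => (hΦ (u (k n))).coeFn_toL1
    refine Lp.ext ?_
    filter_upwards [hae, hcoe, (hΦ x).coeFn_toL1] with a ha hcoea hxa
    refine (tendsto_nhds_unique ha ?_).trans hxa.symm
    simp only [Function.comp_apply, hcoea]
    exact ((Φ a).continuous.tendsto x).comp (hu.comp hk.tendsto_atTop)
  refine ⟨‖(⟨J, hJ⟩ : E →L[ℂ] α →₁[m] F)‖, fun x => ?_⟩
  rw [← L1.norm_of_fun_eq_integral_norm (hΦ x)]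
  exact ContinuousLinearMap.le_opNorm ⟨J, hJ⟩ x

variable {X : Type*} [NormedAddCommGroup X] [NormedSpace ℂ X] {T : ℝ → X →L[ℂ] X}
  {μ : ComplexMeasure (Ioi (0 : ℝ))} {s : ℝ} {P : X →L[ℂ] X}

theorem CalculusDefined.conjMeasure (h : CalculusDefined T μ s) :
    CalculusDefined T (conjMeasure μ) s := by
  intro x
  rw [VectorMeasure.Integrable, variation_conjMeasure]
  exact h x

theorem IsStronglyContinuousSemigroup.map_natCast_add (hT : IsStronglyContinuousSemigroup T)
    (n : ℕ) {r : ℝ} (hr : 0 < r) : T (n + r) = T 1 ^ n * T r := by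
  induction n with
  | zero => simp
  | succ n ih =>
    rw [pow_succ', mul_assoc, ← ih, Nat.cast_succ, add_comm (n : ℝ) 1, add_assoc,
      hT.map_add 1 (n + r) one_pos (by positivity)]
    rfl

theorem IsStronglyContinuousSemigroup.continuous_dilation (hT : IsStronglyContinuousSemigroup T)
    (hs : 0 < s) (x : X) : Continuous fun ξ : Ioi (0 : ℝ) => T (s * ξ) x :=
  (hT.continuousOn x).comp_continuous (by fun_prop) fun ξ => mul_pos hs ξ.2

variable [CompleteSpace X]

theorem CalculusDefined.exists_isCalculus (h : CalculusDefined T μ s) :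
    ∃ P : X →L[ℂ] X, IsCalculus T μ s P := by
  obtain ⟨C, hC⟩ := exists_integral_norm_le h
  let P : X →ₗ[ℂ] X :=
    { toFun := fun x => complexIntegral μ fun ξ => T (s * ξ) x
      map_add' := fun x y => by
        simp only [map_add]
        exact VectorMeasure.integral_add (h x) (h y)
      map_smul' := fun c x => by
        simp only [map_smul]
        exact (apply_complexIntegral (c • ContinuousLinearMap.id ℂ X) (h x)).symm }
  exact ⟨P.mkContinuous C fun x => (norm_complexIntegral_le_integral_norm _ _).trans (hC x), h,
    fun _ => rfl⟩

theorem IsCalculus.apply_comm (hP : IsCalculus T μ s P) (hT : IsStronglyContinuousSemigroup T)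
    (hs : 0 < s) {t : ℝ} (ht : 0 < t) (x : X) : T t (P x) = P (T t x) := by
  rw [hP.2, hP.2, apply_complexIntegral _ (hP.1 x)]
  refine congrArg _ (funext fun ξ => ?_)
  have hξ : 0 < s * (ξ : ℝ) := mul_pos hs ξ.2
  simp only [← ContinuousLinearMap.comp_apply]
  rw [← hT.map_add _ _ ht hξ, ← hT.map_add _ _ hξ ht, add_comm]

theorem IsCalculus.apply_expTransform (hP : IsCalculus T μ s P)
    (hT : IsStronglyContinuousSemigroup T) (hs : 0 < s) {y : X}
    (hy : HasSuperexponentialDecay fun t => T t y) (z : ℂ) :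
    P (expTransform (fun t => T (s * t) y) z) = expTransform (fun t => T (s * t) (P y)) z := by
  rw [(hy.comp_mul_left hs).apply_expTransform]
  refine setIntegral_congr_fun measurableSet_Ioi fun t ht => ?_
  simp only [hP.apply_comm hT hs (mul_pos hs ht)]

theorem IsCalculus.hasSuperexponentialDecay (hP : IsCalculus T μ s P)
    (hT : IsStronglyContinuousSemigroup T) (hs : 0 < s) {y : X}
    (hy : HasSuperexponentialDecay fun t => T t y) :
    HasSuperexponentialDecay fun t => T t (P y) where
  continuousOn := hT.continuousOn _
  exists_norm_le b := by
    obtain ⟨C, hC⟩ := (hy.clm_apply P).exists_norm_le b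
    refine ⟨C, fun t ht => ?_⟩
    rw [hP.apply_comm hT hs ht]
    exact hC t ht

theorem IsCalculus.norm_apply_apply_le (hP : IsCalculus T μ s P)
    (hT : IsStronglyContinuousSemigroup T) (hs : 0 < s) {y : X} {K : ℝ}
    (hK : ∀ t, 0 < t → ‖T t y‖ ≤ K) {t : ℝ} (ht : 0 < t) :
    ‖T t (P y)‖ ≤ K * μ.variation.real univ := by
  rw [hP.apply_comm hT hs ht, hP.2]
  refine norm_complexIntegral_le (.of_forall fun ξ => ?_)
  have hξ : 0 < s * (ξ : ℝ) := mul_pos hs ξ.2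
  rw [← ContinuousLinearMap.comp_apply, ← hT.map_add _ _ hξ ht]
  exact hK _ (add_pos hξ ht)

/-- On the transform `R` of an orbit, `F (-s A)` acts as multiplication by `F z` up to a bounded
error, because `T (s ξ) R` and `exp (-z ξ) • R` differ by a truncated transform. -/
theorem IsCalculus.norm_laplace_smul_sub_le (hP : IsCalculus T μ s P)
    (hT : IsStronglyContinuousSemigroup T) (hs : 0 < s) {y : X}
    (hy : HasSuperexponentialDecay fun t => T t y) {K : ℝ} (hK : ∀ t, 0 < t → ‖T t y‖ ≤ K)
    {z : ℂ} (hz : 0 < z.re) :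
    ‖laplace μ z • expTransform (fun t => T (s * t) y) z -
      P (expTransform (fun t => T (s * t) y) z)‖ ≤ K / z.re * μ.variation.real univ := by
  set R := expTransform (fun t => T (s * t) y) z
  have hys := hy.comp_mul_left hs
  have hexp : μ.Integrable fun ξ : Ioi (0 : ℝ) => Complex.exp (-z * (ξ : ℝ)) :=
    integrable_exp_neg_mul _ hz.le
  have hsmul : laplace μ z • R = complexIntegral μ fun ξ : Ioi (0 : ℝ) =>
      Complex.exp (-z * (ξ : ℝ)) • R :=
    apply_complexIntegral ((ContinuousLinearMap.id ℂ ℂ).smulRight R) hexp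
  have hsub : laplace μ z • R - P R = complexIntegral μ fun ξ : Ioi (0 : ℝ) =>
      Complex.exp (-z * (ξ : ℝ)) • R - T (s * ξ) R := by
    rw [hsmul, hP.2]
    exact (VectorMeasure.integral_sub (hexp.smul_const R) (hP.1 R)).symm
  rw [hsub]
  refine norm_complexIntegral_le (.of_forall fun ξ => ?_)
  have htrans : T (s * ξ) R = expTransform (fun t => T (s * (t + ξ)) y) z := by
    rw [hys.apply_expTransform]
    refine setIntegral_congr_fun measurableSet_Ioi fun t ht => ?_
    simp only [← ContinuousLinearMap.comp_apply]
    rw [← hT.map_add _ _ (mul_pos hs ξ.2) (mul_pos hs ht), mul_add, add_comm]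
  rw [htrans]
  exact hys.norm_exp_smul_expTransform_sub_le (fun t ht => hK _ (mul_pos hs ht)) hz (le_of_lt ξ.2)

theorem IsCalculus.norm_expTransform_le {ν : ComplexMeasure (Ioi (0 : ℝ))} {Q : X →L[ℂ] X}
    (hP : IsCalculus T μ s P) (hQ : IsCalculus T ν s Q) (hT : IsStronglyContinuousSemigroup T)
    (hs : 0 < s) {M : ℝ} (hPQ : ‖P.comp Q‖ ≤ M) {y : X}
    (hy : HasSuperexponentialDecay fun t => T t y) {K : ℝ} (hK : ∀ t, 0 < t → ‖T t y‖ ≤ K)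
    {z : ℂ} (hz : 0 < z.re) (hM : M < ‖laplace μ z * laplace ν z‖) :
    ‖expTransform (fun t => T (s * t) y) z‖ ≤
      2 * K * μ.variation.real univ * ν.variation.real univ /
        (z.re * (‖laplace μ z * laplace ν z‖ - M)) := by
  set R := expTransform (fun t => T (s * t) y) z with hR
  set F := laplace μ z
  set G := laplace ν z
  set m := μ.variation.real univ
  set n := ν.variation.real univ
  have hGQ : ‖G • R - Q R‖ ≤ K / z.re * n := hQ.norm_laplace_smul_sub_le hT hs hy hK hz
  have hFP : ‖F • Q R - P (Q R)‖ ≤ K * n / z.re * m := by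
    rw [hR, hQ.apply_expTransform hT hs hy]
    exact hP.norm_laplace_smul_sub_le hT hs (hQ.hasSuperexponentialDecay hT hs hy)
      (fun t => hQ.norm_apply_apply_le hT hs hK) hz
  have hle : ‖F * G‖ * ‖R‖ ≤ 2 * K * m * n / z.re + M * ‖R‖ := by
    calc ‖F * G‖ * ‖R‖ = ‖F • (G • R - Q R) + (F • Q R - P (Q R)) + P (Q R)‖ := by
          rw [← norm_smul, smul_sub, mul_smul]
          congr 1
          abel
      _ ≤ ‖F‖ * ‖G • R - Q R‖ + ‖F • Q R - P (Q R)‖ + ‖P (Q R)‖ := by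
          rw [← norm_smul]
          exact norm_add₃_le
      _ ≤ m * (K / z.re * n) + K * n / z.re * m + M * ‖R‖ := by
          gcongr
          · exact norm_laplace_le hz.le
          · exact (P.comp Q).le_of_opNorm_le hPQ R
      _ = 2 * K * m * n / z.re + M * ‖R‖ := by ring
  rw [← div_div, le_div_iff₀ (sub_pos.2 hM)]
  linarith

theorem laplace_mul_laplace_conjMeasure_ofReal (μ : ComplexMeasure (Ioi (0 : ℝ))) {x : ℝ}
    (hx : 0 ≤ x) :
    laplace μ x * laplace (conjMeasure μ) x = ((‖laplace μ x‖ ^ 2 : ℝ) : ℂ) := by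
  rw [laplace_conjMeasure (by simpa using hx), Complex.conj_ofReal, Complex.mul_conj']
  norm_cast

theorem exists_norm_apply_zero_le_of_mem_controlledFamily_laplace {x₀ C : ℝ} (hC : 0 ≤ C)
    (hx₀ : 0 < x₀) (hFx₀ : laplace μ x₀ ≠ 0)
    (hmax : ∀ x : ℝ, 0 ≤ x → ‖laplace μ x‖ ≤ ‖laplace μ x₀‖) (hμ : μ univ = 0) :
    ∃ B : ℝ, ∀ f ∈ controlledFamily (fun z => laplace μ z * laplace (conjMeasure μ) z)
      (‖laplace μ x₀‖ ^ 2) C, ‖f 0‖ ≤ B := by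
  refine exists_norm_apply_zero_le_of_mem_controlledFamily hC
    (diffContOnCl_laplace.smul diffContOnCl_laplace)
    (b := μ.variation.real univ * (conjMeasure μ).variation.real univ)
    (fun z hz => ?_) (fun z hz => ?_) (fun x hx => ?_) hx₀
    (laplace_mul_laplace_conjMeasure_ofReal μ hx₀.le) ?_
  · rw [norm_mul]
    gcongr <;> exact norm_laplace_le hz.le
  · rw [laplace_conjMeasure (by simpa using hz.le), laplace_conjMeasure hz.le]
    simp only [map_mul, Complex.conj_conj, mul_comm]
  · rw [laplace_mul_laplace_conjMeasure_ofReal μ hx, Complex.norm_of_nonneg (by positivity)]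
    gcongr
    exact hmax x hx
  · rw [laplace_zero, hμ, zero_mul]
    exact_mod_cast (pow_pos (norm_pos_iff.2 hFx₀) 2).ne

/-- `B` does not depend on `s`, because the bounds on the transform of the dilated orbit do not. -/
theorem exists_norm_integral_le_of_norm_comp_le (hT : IsStronglyContinuousSemigroup T) {x₀ : ℝ}
    (hx₀ : 0 < x₀) (hFx₀ : laplace μ x₀ ≠ 0)
    (hmax : ∀ x : ℝ, 0 ≤ x → ‖laplace μ x‖ ≤ ‖laplace μ x₀‖) (hμ : μ univ = 0) {y : X}
    (hy : HasSuperexponentialDecay fun t => T t y) :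
    ∃ B : ℝ, ∀ s : ℝ, 0 < s → ∀ P Q : X →L[ℂ] X, IsCalculus T μ s P →
      IsCalculus T (conjMeasure μ) s Q → ‖P.comp Q‖ ≤ ‖laplace μ x₀‖ ^ 2 →
        ‖∫ t in Ioi (0 : ℝ), T t y‖ ≤ B * s := by
  obtain ⟨K, hK⟩ := hy.exists_norm_le_const
  have hK₀ : 0 ≤ K := (norm_nonneg _).trans (hK 1 one_pos)
  set C := max K (2 * K * μ.variation.real univ * (conjMeasure μ).variation.real univ)
  obtain ⟨B, hB⟩ := exists_norm_apply_zero_le_of_mem_controlledFamily_laplace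
    (hK₀.trans (le_max_left _ _) : 0 ≤ C) hx₀ hFx₀ hmax hμ
  refine ⟨B, fun s hs P Q hP hQ hPQ => ?_⟩
  set R := expTransform fun t => T (s * t) y with hR
  obtain ⟨l, hl, hlR⟩ := exists_dual_vector'' ℂ (R 0)
  have hlR_le : ∀ z, ‖l (R z)‖ ≤ ‖R z‖ := fun z => by
    simpa only [one_mul] using l.le_of_opNorm_le hl (R z)
  have hmem : (fun z => l (R z)) ∈ controlledFamily
      (fun z => laplace μ z * laplace (conjMeasure μ) z) (‖laplace μ x₀‖ ^ 2) C := by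
    refine ⟨l.differentiable.comp (hy.comp_mul_left hs).differentiable_expTransform,
      fun z hz => (hlR_le z).trans ?_, fun z hz hM => (hlR_le z).trans ?_⟩
    · refine (norm_expTransform_le (fun t ht => hK _ (mul_pos hs ht)) hz).trans ?_
      have := neg_pos.2 hz
      gcongr
      exact le_max_left _ _
    · refine (hP.norm_expTransform_le hQ hT hs hPQ hy hK hz hM).trans ?_
      have := sub_pos.2 hM
      gcongr
      exact le_max_right _ _
  have hR₀ : ‖R 0‖ ≤ B := by
    simpa only [hlR, RCLike.norm_ofReal, abs_norm] using hB _ hmem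
  rwa [hR, expTransform_comp_mul_left_zero (fun t => T t y) hs, norm_smul, norm_inv,
    Real.norm_of_nonneg hs.le, inv_mul_le_iff₀ hs, mul_comm] at hR₀

theorem exists_norm_pow_le_of_spectralRadius_eq_zero {A : Type*} [NormedRing A] [NormedAlgebra ℂ A]
    [CompleteSpace A] {a : A} (ha : spectralRadius ℂ a = 0) (b : ℝ) :
    ∃ C : ℝ, 0 < C ∧ ∀ n : ℕ, ‖a ^ n‖ ≤ C * Real.exp (-(b * n)) := by
  have hlt : ∀ᶠ n : ℕ in atTop,
      ENNReal.ofReal (‖a ^ n‖ ^ (1 / n : ℝ)) < ENNReal.ofReal (Real.exp (-b)) := by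
    refine (spectrum.pow_norm_pow_one_div_tendsto_nhds_spectralRadius a).eventually_lt_const ?_
    rw [ha]
    exact ENNReal.ofReal_pos.2 (Real.exp_pos _)
  have hO : (fun n : ℕ => a ^ n) =O[atTop] fun n : ℕ => Real.exp (-(b * n)) := by
    refine .of_bound 1 ?_
    filter_upwards [hlt, eventually_gt_atTop 0] with n hn hn₀
    rw [ENNReal.ofReal_lt_ofReal_iff (Real.exp_pos _)] at hn
    rw [one_mul, Real.norm_of_nonneg (Real.exp_pos _).le, ← neg_mul, mul_comm, Real.exp_nat_mul,
      ← Real.rpow_inv_natCast_pow (norm_nonneg (a ^ n)) hn₀.ne', ← one_div]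
    gcongr
  obtain ⟨C, hC₀, hC⟩ := Asymptotics.bound_of_isBigO_nat_atTop hO
  refine ⟨C, hC₀, fun n => ?_⟩
  simpa using hC (Real.exp_pos _).ne'

namespace IsStronglyContinuousSemigroup

theorem exists_norm_le_of_mem_Icc (hT : IsStronglyContinuousSemigroup T) {a : ℝ} (ha : 0 < a)
    (b : ℝ) : ∃ C : ℝ, ∀ t ∈ Icc a b, ‖T t‖ ≤ C := by
  have hpointwise : ∀ x : X, ∃ C, ∀ t : Icc a b, ‖T t x‖ ≤ C := fun x => by
    obtain ⟨C, hC⟩ := isCompact_Icc.exists_bound_of_continuousOn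
      ((hT.continuousOn x).mono fun t (ht : t ∈ Icc a b) => ha.trans_le ht.1)
    exact ⟨C, fun t => hC t t.2⟩
  obtain ⟨C, hC⟩ := banach_steinhaus hpointwise
  exact ⟨C, fun t ht => hC ⟨t, ht⟩⟩

theorem exists_norm_le_exp (hT : IsStronglyContinuousSemigroup T) (hq : IsQuasinilpotent T)
    {a : ℝ} (ha : 0 < a) (b : ℝ) :
    ∃ C : ℝ, ∀ t : ℝ, a ≤ t → ‖T t‖ ≤ C * Real.exp (-(b * t)) := by
  obtain ⟨C₁, hC₁₀, hC₁⟩ := exists_norm_pow_le_of_spectralRadius_eq_zero (hq 1 one_pos) b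
  obtain ⟨C₂, hC₂⟩ := hT.exists_norm_le_of_mem_Icc ha (a + 1)
  have hC₂₀ : 0 ≤ C₂ := (norm_nonneg _).trans (hC₂ a ⟨le_rfl, by linarith⟩)
  refine ⟨C₁ * C₂ * Real.exp (|b| * (a + 1)), fun t ht => ?_⟩
  set n := ⌊t - a⌋₊
  have hn : (n : ℝ) ≤ t - a := Nat.floor_le (sub_nonneg.2 ht)
  have hn' : t - a < n + 1 := Nat.lt_floor_add_one _
  have hexp : -(b * n) ≤ |b| * (a + 1) + -(b * t) := by
    have hbr : b * (t - n) ≤ |b| * (a + 1) :=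
      mul_le_mul (le_abs_self b) (by linarith) (by linarith) (abs_nonneg b)
    linarith
  calc ‖T t‖ = ‖T 1 ^ n * T (t - n)‖ := by
        rw [← hT.map_natCast_add n (by linarith), add_sub_cancel]
    _ ≤ ‖T 1 ^ n‖ * ‖T (t - n)‖ := norm_mul_le _ _
    _ ≤ (C₁ * Real.exp (-(b * n))) * C₂ := by
        gcongr
        · exact hC₁ n
        · exact hC₂ _ ⟨by linarith, by linarith⟩
    _ ≤ (C₁ * Real.exp (|b| * (a + 1) + -(b * t))) * C₂ := by gcongr
    _ = C₁ * C₂ * Real.exp (|b| * (a + 1)) * Real.exp (-(b * t)) := by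
        rw [Real.exp_add]
        ring

theorem hasSuperexponentialDecay_orbit (hT : IsStronglyContinuousSemigroup T)
    (hq : IsQuasinilpotent T) {a : ℝ} (ha : 0 < a) (x : X) :
    HasSuperexponentialDecay fun t => T t (T a x) where
  continuousOn := hT.continuousOn _
  exists_norm_le b := by
    obtain ⟨C, hC⟩ := hT.exists_norm_le_exp hq ha b
    refine ⟨C * Real.exp (-(b * a)) * ‖x‖, fun t ht => ?_⟩
    rw [← ContinuousLinearMap.comp_apply, ← hT.map_add _ _ ht ha]
    refine ((T (t + a)).le_of_opNorm_le (hC _ (le_add_of_nonneg_left ht.le)) x).trans_eq ?_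
    rw [mul_add, neg_add, Real.exp_add]
    ring

theorem exists_integral_orbit_ne_zero (hT : IsStronglyContinuousSemigroup T)
    (hq : IsQuasinilpotent T) (hT₀ : ∃ t : ℝ, 0 < t ∧ T t ≠ 0) :
    ∃ a : ℝ, 0 < a ∧ ∃ x, ∫ t in Ioi (0 : ℝ), T t (T a x) ≠ 0 := by
  obtain ⟨c, hc, hTc⟩ := hT₀
  by_contra! hzero
  refine hTc (ContinuousLinearMap.ext fun x => ?_)
  have hc₂ : 0 < c / 2 := half_pos hc
  rw [← add_halves c, hT.map_add _ _ hc₂ hc₂]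
  refine (hT.hasSuperexponentialDecay_orbit hq hc₂ x).eq_zero_of_integral_Ioi_eq_zero
    (fun b hb => ?_) hc₂
  rw [← integral_Ioi_comp_add_right, ← hzero b hb (T (c / 2) x)]
  refine setIntegral_congr_fun measurableSet_Ioi fun t ht => ?_
  simp only [hT.map_add _ _ (mem_Ioi.1 ht) hb, ContinuousLinearMap.comp_apply]

theorem calculusDefined_of_eventually_norm_le (hT : IsStronglyContinuousSemigroup T)
    (hq : IsQuasinilpotent T) {s δ C : ℝ} (hs : 0 < s) (hδ : 0 < δ)
    (hC : ∀ᵐ ξ : Ioi (0 : ℝ) ∂μ.variation, s * (ξ : ℝ) ≤ δ → ‖T (s * ξ)‖ ≤ C) :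
    CalculusDefined T μ s := by
  obtain ⟨C', hC'⟩ := hT.exists_norm_le_exp hq hδ 0
  refine fun x => Integrable.of_bound (hT.continuous_dilation hs x).aestronglyMeasurable
    (max C C' * ‖x‖) ?_
  filter_upwards [hC] with ξ hξ
  refine (T _).le_of_opNorm_le ?_ x
  rcases le_total (s * (ξ : ℝ)) δ with hle | hge
  · exact (hξ hle).trans (le_max_left _ _)
  · refine le_max_of_le_right ?_
    simpa using hC' _ hge

theorem calculusDefined_of_norm_le (hT : IsStronglyContinuousSemigroup T)
    (hq : IsQuasinilpotent T) (μ : ComplexMeasure (Ioi (0 : ℝ))) {s δ C : ℝ} (hs : 0 < s)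
    (hδ : 0 < δ) (hC : ∀ t : ℝ, 0 < t → t ≤ δ → ‖T t‖ ≤ C) : CalculusDefined T μ s :=
  hT.calculusDefined_of_eventually_norm_le hq hs hδ <|
    .of_forall fun ξ => hC _ (mul_pos hs ξ.2)

theorem calculusDefined_of_variation_eq_zero (hT : IsStronglyContinuousSemigroup T)
    (hq : IsQuasinilpotent T) {s δ : ℝ} (hs : 0 < s) (hδ : 0 < δ)
    (hμδ : μ.variation {ξ : Ioi (0 : ℝ) | (ξ : ℝ) < δ} = 0) : CalculusDefined T μ s := by
  have hδs : 0 < s * δ := mul_pos hs hδ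
  refine hT.calculusDefined_of_eventually_norm_le (C := 0) hq hs (half_pos hδs) ?_
  filter_upwards [measure_eq_zero_iff_ae_notMem.1 hμδ] with ξ hξ hle
  exact absurd (lt_of_mul_lt_mul_left (hle.trans_lt (half_lt_self hδs)) hs.le) hξ

end IsStronglyContinuousSemigroup

end Semigroup

theorem mainTheorem2 {X : Type*} [NormedAddCommGroup X] [NormedSpace ℂ X] [CompleteSpace X]
    (T : ℝ → X →L[ℂ] X) (hT : IsStronglyContinuousSemigroup T) (hq : IsQuasinilpotent T)
    (hT0 : ∃ t : ℝ, 0 < t ∧ T t ≠ 0)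
    (μ : ComplexMeasure (Set.Ioi (0 : ℝ))) (hμ0 : μ ≠ 0) (hμ : μ Set.univ = 0) :
    -- the calculus is defined for every dilation if `T` is bounded near `0`, or if `μ` vanishes there
    (((∃ δ C : ℝ, 0 < δ ∧ ∀ t : ℝ, 0 < t → t ≤ δ → ‖T t‖ ≤ C) ∨
        (∃ δ : ℝ, 0 < δ ∧ μ.variation {ξ : Set.Ioi (0 : ℝ) | (ξ : ℝ) < δ} = 0)) →
      ∀ s : ℝ, 0 < s → CalculusDefined T μ s) ∧
    -- the lower estimate, at every small dilation at which the calculus is defined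
    ∃ M : ℝ, IsGreatest ((fun x : ℝ => ‖laplace μ (x : ℂ)‖ ^ 2) '' Set.Ici 0) M ∧
      ∃ η : ℝ, 0 < η ∧ ∀ s : ℝ, 0 < s → s ≤ η → CalculusDefined T μ s →
        ∃ P Q : X →L[ℂ] X, IsCalculus T μ s P ∧ IsCalculus T (conjMeasure μ) s Q ∧
          M < ‖P.comp Q‖ := by
  refine ⟨?_, ?_⟩
  · rintro (⟨δ, C, hδ, hC⟩ | ⟨δ, hδ, hμδ⟩) s hs
    · exact hT.calculusDefined_of_norm_le hq μ hs hδ hC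
    · exact hT.calculusDefined_of_variation_eq_zero hq hs hδ hμδ
  obtain ⟨x₀, hx₀, hFx₀, hmax⟩ := exists_isMaxOn_norm_laplace hμ0 hμ
  obtain ⟨a, ha, x, hI⟩ := hT.exists_integral_orbit_ne_zero hq hT0
  obtain ⟨B, hB⟩ := exists_norm_integral_le_of_norm_comp_le hT hx₀ hFx₀ hmax hμ
    (hT.hasSuperexponentialDecay_orbit hq ha x)
  have hsmall : ∀ᶠ s in 𝓝 (0 : ℝ), B * s < ‖∫ t in Ioi (0 : ℝ), T t (T a x)‖ :=
    ContinuousAt.eventually_lt (by fun_prop) continuousAt_const (by simpa using hI)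
  obtain ⟨η, hη, hBη⟩ := Metric.eventually_nhds_iff_ball.1 hsmall
  refine ⟨‖laplace μ x₀‖ ^ 2, ⟨⟨x₀, hx₀.le, rfl⟩, ?_⟩, η / 2, half_pos hη, fun s hs hsη hdef => ?_⟩
  · rintro _ ⟨x, hx, rfl⟩
    exact pow_le_pow_left₀ (norm_nonneg _) (hmax x hx) 2
  obtain ⟨P, hP⟩ := hdef.exists_isCalculus
  obtain ⟨Q, hQ⟩ := hdef.conjMeasure.exists_isCalculus
  refine ⟨P, Q, hP, hQ, lt_of_not_ge fun hPQ => (hB s hs P Q hP hQ hPQ).not_gt (hBη s ?_)⟩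
  rw [Real.ball_eq_Ioo]
  exact ⟨by linarith, by linarith⟩
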